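/- Let $k$ be a field and let $H$ be a Hopf algebra over $k$ with bijective antipode $S$, comultiplication $\Delta(h)=h_1\otimes h_2$, counit $\epsilon$ and centre $\mathrm{Z}(H)$ (Sweedler notation, summation omitted). Let $R=R^{(1)}\otimes R^{(2)}\in H\otimes H$ be an invertible element, and let $R'=R'^{(1)}\otimes R'^{(2)}$ denote a second copy of $R$; tensor products are over $k$. Assume that $(H,R)$ is a semiquasitriangular Hopf algebra, i.e. that 1. $R^{(1)}_1\otimes R^{(1)}_2\otimes R^{(2)}=R^{(1)}\otimes R'^{(1)}\otimes R^{(2)}R'^{(2)}$, 2. $R^{(1)}\otimes R^{(2)}_1\otimes R^{(2)}_2=R^{(1)}R'^{(1)}\otimes R'^{(2)}\otimes R^{(2)}$, 3. $R^{(1)}\otimes R^{(2)}_2R'^{(1)}\otimes R^{(2)}_1R'^{(2)}=R^{(1)}\otimes R'^{(1)}R^{(2)}_1\otimes R'^{(2)}R^{(2)}_2$, 4. $R^{(1)}_2R'^{(1)}\otimes R^{(1)}_1R'^{(2)}\otimes R^{(2)}=R'^{(1)}R^{(1)}_1\otimes R'^{(2)}R^{(1)}_2\otimes R^{(2)}$,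 5. $\nu(h):=R^{(2)}h_2R'^{(2)}\otimes S(h_1)S(R^{(1)})h_3R'^{(1)}\in H\otimes\mathrm{Z}(H)$ for all $h\in H$, 6. $\nu(h)=R^{(1)}h_2R'^{(1)}\otimes S(R'^{(2)})S(h_1)R^{(2)}h_3$ for all $h\in H$. A (left-right) normal $(H,R)$-module is a $k$-vector space $M$ with a left $H$-module structure and a right $H$-comodule structure $\nu_M(m)=m_0\otimes m_1$ such that, for all $h\in H$ and $m\in M$, $\nu_M(m)\in M\otimes\mathrm{Z}(H)$ and $$\nu_M(h\cdot m)=R^{(2)}h_2R'^{(2)}\cdot m_0\otimes S(h_1)S(R^{(1)})h_3R'^{(1)}m_1 .$$ Morphisms of normal $(H,R)$-modules are the $k$-linear maps that are $H$-linear and $H$-colinear. Theorem. The category of normal $(H,R)$-modules is a braided monoidal category. The unit object is $k$ with the trivial action $h\cdot x=\epsilon(h)x$ and the trivial coaction $x\mapsto x\otimes 1$. The tensor product is the usual tensor product over $k$ (of vector spaces and of linear maps), with the diagonal action $h\cdot(m\otimes n)=h_1\cdot m\otimes h_2\cdot n$ and the diagonal coaction $m\otimes n\mapsto m_0\otimes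 n_0\otimes m_1n_1$. The associativity and unit constraints are the usual ones of vector spaces, and the braiding $c_{MN}\colon M\otimes N\to N\otimes M$ is $$c_{MN}(m\otimes n)=R^{(2)}\cdot n_0\otimes R^{(1)}n_1\cdot m .$$ -/

import Mathlib

open CategoryTheory MonoidalCategory TensorProduct

universe u v

noncomputable section

namespace SemiQT

section Semiquasitriangular

variable {k : Type u} {H : Type v} [Field k] [Ring H] [HopfAlgebra k H]

/-- The element `1 ⊗ R = R₂₃` of `H ⊗ (H ⊗ H)`. -/
def leg23 (R : H ⊗[k] H) : H ⊗[k] (H ⊗[k] H) := (1 : H) ⊗ₜ[k] R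

/-- The element `R⁽¹⁾ ⊗ R⁽²⁾ ⊗ 1 = R₁₂` of `H ⊗ (H ⊗ H)`. -/
def leg12 (R : H ⊗[k] H) : H ⊗[k] (H ⊗[k] H) :=
  TensorProduct.assoc k H H H (R ⊗ₜ[k] (1 : H))

/-- The element `R⁽¹⁾ ⊗ 1 ⊗ R⁽²⁾ = R₁₃` of `H ⊗ (H ⊗ H)`. -/
def leg13 (R : H ⊗[k] H) : H ⊗[k] (H ⊗[k] H) :=
  (TensorProduct.mk k H H 1).lTensor H R

/-- `(Δ ⊗ id)(R) = R⁽¹⁾₁ ⊗ R⁽¹⁾₂ ⊗ R⁽²⁾`. -/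
def comulLeft (R : H ⊗[k] H) : H ⊗[k] (H ⊗[k] H) :=
  TensorProduct.assoc k H H H ((Coalgebra.comul (R := k) (A := H)).rTensor H R)

/-- `(Δᶜᵒᵖ ⊗ id)(R) = R⁽¹⁾₂ ⊗ R⁽¹⁾₁ ⊗ R⁽²⁾`. -/
def comulCopLeft (R : H ⊗[k] H) : H ⊗[k] (H ⊗[k] H) :=
  TensorProduct.assoc k H H H
    (((TensorProduct.comm k H H).toLinearMap ∘ₗ Coalgebra.comul (R := k) (A := H)).rTensor H R)

/-- `(id ⊗ Δ)(R) = R⁽¹⁾ ⊗ R⁽²⁾₁ ⊗ R⁽²⁾₂`. -/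
def comulRight (R : H ⊗[k] H) : H ⊗[k] (H ⊗[k] H) :=
  (Coalgebra.comul (R := k) (A := H)).lTensor H R

/-- `(id ⊗ Δᶜᵒᵖ)(R) = R⁽¹⁾ ⊗ R⁽²⁾₂ ⊗ R⁽²⁾₁`. -/
def comulCopRight (R : H ⊗[k] H) : H ⊗[k] (H ⊗[k] H) :=
  ((TensorProduct.comm k H H).toLinearMap ∘ₗ Coalgebra.comul (R := k) (A := H)).lTensor H R

/-- The map `h ↦ 1 ⊗ S(h)`. -/
def oneTmulAntipode : H →ₗ[k] H ⊗[k] H :=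
  TensorProduct.mk k H H 1 ∘ₗ HopfAlgebra.antipode k (A := H)

/-- The element `R⁽²⁾ ⊗ S(R⁽¹⁾)` of `H ⊗ H`. -/
def flipAntipode (R : H ⊗[k] H) : H ⊗[k] H :=
  TensorProduct.comm k H H ((HopfAlgebra.antipode k (A := H)).rTensor H R)

/-- The map `ν(h) = R⁽²⁾ h₂ R'⁽²⁾ ⊗ S(h₁) S(R⁽¹⁾) h₃ R'⁽¹⁾`, that is, in the algebra `H ⊗ H`,
`ν(h) = (1 ⊗ S(h₁)) * (R⁽²⁾ ⊗ S(R⁽¹⁾)) * (h₂ ⊗ h₃) * (R'⁽²⁾ ⊗ R'⁽¹⁾)`. -/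
def nu (R : H ⊗[k] H) : H →ₗ[k] H ⊗[k] H :=
  LinearMap.mul' k (H ⊗[k] H) ∘ₗ
    TensorProduct.map oneTmulAntipode
      (LinearMap.mulLeft k (flipAntipode R) ∘ₗ
        LinearMap.mulRight k (TensorProduct.comm k H H R) ∘ₗ
          Coalgebra.comul (R := k) (A := H)) ∘ₗ
    Coalgebra.comul (R := k) (A := H)

/-- For `X ∈ H ⊗ H`, the linear map `a ⊗ b ↦ (1 ⊗ S(b)) * X * (a ⊗ 1)` on `H ⊗ H`. -/
def sandwich (X : H ⊗[k] H) : H ⊗[k] H →ₗ[k] H ⊗[k] H :=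
  LinearMap.mul' k (H ⊗[k] H) ∘ₗ
    TensorProduct.map (LinearMap.mulRight k X ∘ₗ oneTmulAntipode)
      ((TensorProduct.mk k H H).flip 1) ∘ₗ
    (TensorProduct.comm k H H).toLinearMap

/-- The map `h ↦ R⁽¹⁾ h₂ R'⁽¹⁾ ⊗ S(R'⁽²⁾) S(h₁) R⁽²⁾ h₃`, that is, in the algebra `H ⊗ H`,
`(1 ⊗ S(R'⁽²⁾)) * [(1 ⊗ S(h₁)) * (R⁽¹⁾ ⊗ R⁽²⁾) * (h₂ ⊗ h₃)] * (R'⁽¹⁾ ⊗ 1)`. -/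
def nu' (R : H ⊗[k] H) (h : H) : H ⊗[k] H :=
  sandwich
    (LinearMap.mul' k (H ⊗[k] H)
      (TensorProduct.map oneTmulAntipode
        (LinearMap.mulLeft k R ∘ₗ Coalgebra.comul (R := k) (A := H))
        (Coalgebra.comul (R := k) h)))
    R

variable (k H) in
/-- The subspace `M ⊗ Z(H)` of `M ⊗ H`, where `Z(H)` is the centre of `H`. -/
def tensorCenter (M : Type*) [AddCommGroup M] [Module k M] : Submodule k (M ⊗[k] H) :=
  LinearMap.range ((Subalgebra.toSubmodule (Subalgebra.center k H)).subtype.lTensor M)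

/-- `R ∈ H ⊗ H` is a semiquasitriangular structure for the Hopf algebra `H`, i.e. `(H, R)` is a
semiquasitriangular Hopf algebra. -/
structure IsSemiquasitriangular (R : H ⊗[k] H) : Prop where
  antipode_bijective : Function.Bijective (HopfAlgebra.antipode k (A := H))
  isUnit : IsUnit R
  /-- `R⁽¹⁾₁ ⊗ R⁽¹⁾₂ ⊗ R⁽²⁾ = R⁽¹⁾ ⊗ R'⁽¹⁾ ⊗ R⁽²⁾ R'⁽²⁾`. -/
  comul_left : comulLeft R = leg13 R * leg23 R
  /-- `R⁽¹⁾ ⊗ R⁽²⁾₁ ⊗ R⁽²⁾₂ = R⁽¹⁾ R'⁽¹⁾ ⊗ R'⁽²⁾ ⊗ R⁽²⁾`. -/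
  comul_right : comulRight R = leg13 R * leg12 R
  /-- `R⁽¹⁾ ⊗ R⁽²⁾₂ R'⁽¹⁾ ⊗ R⁽²⁾₁ R'⁽²⁾ = R⁽¹⁾ ⊗ R'⁽¹⁾ R⁽²⁾₁ ⊗ R'⁽²⁾ R⁽²⁾₂`. -/
  cop_right : comulCopRight R * leg23 R = leg23 R * comulRight R
  /-- `R⁽¹⁾₂ R'⁽¹⁾ ⊗ R⁽¹⁾₁ R'⁽²⁾ ⊗ R⁽²⁾ = R'⁽¹⁾ R⁽¹⁾₁ ⊗ R'⁽²⁾ R⁽¹⁾₂ ⊗ R⁽²⁾`. -/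
  cop_left : comulCopLeft R * leg12 R = leg12 R * comulLeft R
  nu_mem : ∀ h : H, nu R h ∈ tensorCenter k H H
  nu_eq : ∀ h : H, nu R h = nu' R h

end Semiquasitriangular

section ModComod

variable (k : Type u) (H : Type v) [Field k] [Ring H] [HopfAlgebra k H]

/-- A `k`-vector space with a left action of `H`, given as the representation
`h ↦ (m ↦ h · m)`, and a right coaction `m ↦ m₀ ⊗ m₁` of `H`. -/
structure ModComod where
  carrier : Type u
  [addCommGroup : AddCommGroup carrier]
  [module : Module k carrier]
  act : H →ₐ[k] Module.End k carrier
  coact : carrier →ₗ[k] carrier ⊗[k] H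
  coassoc : (TensorProduct.assoc k carrier H H).toLinearMap ∘ₗ coact.rTensor H ∘ₗ coact =
    (Coalgebra.comul (R := k) (A := H)).lTensor carrier ∘ₗ coact
  counit : (TensorProduct.rid k carrier).toLinearMap ∘ₗ
    (Coalgebra.counit (R := k) (A := H)).lTensor carrier ∘ₗ coact = LinearMap.id

namespace ModComod

attribute [instance] ModComod.addCommGroup ModComod.module

variable {k H}

instance : CoeSort (ModComod k H) (Type u) := ⟨ModComod.carrier⟩

/-- A morphism: a linear map that is `H`-linear and `H`-colinear. -/
@[ext]
structure Hom (M N : ModComod k H) where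
  lin : M →ₗ[k] N
  map_act : ∀ h : H, lin ∘ₗ M.act h = N.act h ∘ₗ lin
  map_coact : lin.rTensor H ∘ₗ M.coact = N.coact ∘ₗ lin

instance : Category (ModComod k H) where
  Hom := Hom
  id M := ⟨LinearMap.id, fun _ => rfl, by simp⟩
  comp f g := ⟨g.lin ∘ₗ f.lin,
    fun h => by rw [LinearMap.comp_assoc, f.map_act, ← LinearMap.comp_assoc, g.map_act,
      LinearMap.comp_assoc],
    by rw [LinearMap.rTensor_comp, LinearMap.comp_assoc, f.map_coact, ← LinearMap.comp_assoc,
      g.map_coact, LinearMap.comp_assoc]⟩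

@[simp] lemma id_lin (M : ModComod k H) : Hom.lin (𝟙 M) = LinearMap.id := rfl

@[simp] lemma comp_lin {M N P : ModComod k H} (f : M ⟶ N) (g : N ⟶ P) :
    Hom.lin (f ≫ g) = Hom.lin g ∘ₗ Hom.lin f := rfl

lemma hom_ext {M N : ModComod k H} {f g : M ⟶ N} (h : Hom.lin f = Hom.lin g) : f = g :=
  Hom.ext h

section Data

variable {M N : Type u} [AddCommGroup M] [Module k M] [AddCommGroup N] [Module k N]

/-- The action of `H ⊗ H` on `M ⊗ N`: `(a ⊗ b) · (m ⊗ n) = a · m ⊗ b · n`. -/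
def tensorAct (a : H →ₐ[k] Module.End k M) (b : H →ₐ[k] Module.End k N) :
    H ⊗[k] H →ₐ[k] Module.End k (M ⊗[k] N) :=
  (Module.endTensorEndAlgHom (R := k) (S := k) (A := k)).comp (Algebra.TensorProduct.map a b)

@[simp] lemma tensorAct_tmul (a : H →ₐ[k] Module.End k M) (b : H →ₐ[k] Module.End k N)
    (x y : H) : tensorAct a b (x ⊗ₜ[k] y) = TensorProduct.map (a x) (b y) := rfl

/-- The diagonal action `h · (m ⊗ n) = h₁ · m ⊗ h₂ · n`. -/
def diagAct (a : H →ₐ[k] Module.End k M) (b : H →ₐ[k] Module.End k N) :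
    H →ₐ[k] Module.End k (M ⊗[k] N) :=
  (tensorAct a b).comp (Bialgebra.comulAlgHom k H)

/-- The map `(m ⊗ x) ⊗ (n ⊗ y) ↦ (m ⊗ n) ⊗ x y`. -/
def mulLegs : (M ⊗[k] H) ⊗[k] (N ⊗[k] H) →ₗ[k] (M ⊗[k] N) ⊗[k] H :=
  (LinearMap.mul' k H).lTensor (M ⊗[k] N) ∘ₗ
    (TensorProduct.tensorTensorTensorComm k M H N H).toLinearMap

@[simp] lemma mulLegs_tmul (m : M) (n : N) (x y : H) :
    mulLegs ((m ⊗ₜ[k] x) ⊗ₜ[k] (n ⊗ₜ[k] y)) = (m ⊗ₜ[k] n) ⊗ₜ[k] (x * y) := rfl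

/-- The diagonal coaction `m ⊗ n ↦ m₀ ⊗ n₀ ⊗ m₁ n₁`. -/
def diagCoact (c : M →ₗ[k] M ⊗[k] H) (d : N →ₗ[k] N ⊗[k] H) :
    M ⊗[k] N →ₗ[k] (M ⊗[k] N) ⊗[k] H :=
  mulLegs ∘ₗ TensorProduct.map c d

lemma diagCoact_tmul (c : M →ₗ[k] M ⊗[k] H) (d : N →ₗ[k] N ⊗[k] H) (m : M) (n : N) :
    diagCoact c d (m ⊗ₜ[k] n) = mulLegs (c m ⊗ₜ[k] d n) := rfl

/-- The map `(m ⊗ x) ⊗ (n ⊗ y) ↦ (m ⊗ n) ⊗ x y` for `x, y ∈ H ⊗ H`. -/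
def mulLegs₂ : (M ⊗[k] (H ⊗[k] H)) ⊗[k] (N ⊗[k] (H ⊗[k] H)) →ₗ[k]
    (M ⊗[k] N) ⊗[k] (H ⊗[k] H) :=
  (LinearMap.mul' k (H ⊗[k] H)).lTensor (M ⊗[k] N) ∘ₗ
    (TensorProduct.tensorTensorTensorComm k M (H ⊗[k] H) N (H ⊗[k] H)).toLinearMap

lemma assoc_mulLegs (x y : H) (u : M ⊗[k] H) (w : N ⊗[k] H) :
    TensorProduct.assoc k (M ⊗[k] N) H H (mulLegs (u ⊗ₜ[k] w) ⊗ₜ[k] (x * y)) =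
      mulLegs₂ (TensorProduct.assoc k M H H (u ⊗ₜ[k] x) ⊗ₜ[k]
        TensorProduct.assoc k N H H (w ⊗ₜ[k] y)) := by
  induction u with
  | zero => simp
  | add a b ha hb => simp only [TensorProduct.add_tmul, map_add, ha, hb]
  | tmul m a =>
    induction w with
    | zero => simp
    | add c d hc hd => simp only [TensorProduct.add_tmul, TensorProduct.tmul_add, map_add, hc, hd]
    | tmul n b => simp [mulLegs₂]

lemma assoc_diagCoact (c : M →ₗ[k] M ⊗[k] H) (d : N →ₗ[k] N ⊗[k] H)
    (u : M ⊗[k] H) (w : N ⊗[k] H) :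
    TensorProduct.assoc k (M ⊗[k] N) H H ((diagCoact c d).rTensor H (mulLegs (u ⊗ₜ[k] w))) =
      mulLegs₂ (TensorProduct.assoc k M H H (c.rTensor H u) ⊗ₜ[k]
        TensorProduct.assoc k N H H (d.rTensor H w)) := by
  induction u with
  | zero => simp
  | add a b ha hb => simp only [TensorProduct.add_tmul, map_add, ha, hb]
  | tmul m a =>
    induction w with
    | zero => simp
    | add a b ha hb => simp only [TensorProduct.tmul_add, map_add, ha, hb]
    | tmul n b =>
      simp only [mulLegs_tmul, LinearMap.rTensor_tmul, diagCoact_tmul, assoc_mulLegs]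

lemma comul_mulLegs (u : M ⊗[k] H) (w : N ⊗[k] H) :
    (Coalgebra.comul (R := k) (A := H)).lTensor (M ⊗[k] N) (mulLegs (u ⊗ₜ[k] w)) =
      mulLegs₂ ((Coalgebra.comul (R := k) (A := H)).lTensor M u ⊗ₜ[k]
        (Coalgebra.comul (R := k) (A := H)).lTensor N w) := by
  induction u with
  | zero => simp
  | add a b ha hb => simp only [TensorProduct.add_tmul, map_add, ha, hb]
  | tmul m a =>
    induction w with
    | zero => simp
    | add a b ha hb => simp only [TensorProduct.tmul_add, map_add, ha, hb]
    | tmul n b => simp [mulLegs₂]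

lemma counit_mulLegs (u : M ⊗[k] H) (w : N ⊗[k] H) :
    TensorProduct.rid k (M ⊗[k] N)
        ((Coalgebra.counit (R := k) (A := H)).lTensor (M ⊗[k] N) (mulLegs (u ⊗ₜ[k] w))) =
      TensorProduct.rid k M ((Coalgebra.counit (R := k) (A := H)).lTensor M u) ⊗ₜ[k]
        TensorProduct.rid k N ((Coalgebra.counit (R := k) (A := H)).lTensor N w) := by
  induction u with
  | zero => simp
  | add a b ha hb => simp only [TensorProduct.add_tmul, map_add, ha, hb]
  | tmul m a =>
    induction w with
    | zero => simp
    | add a b ha hb => simp only [TensorProduct.tmul_add, map_add, ha, hb]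
    | tmul n b =>
      simp only [mulLegs_tmul, LinearMap.lTensor_tmul, Bialgebra.counit_mul, TensorProduct.rid_tmul,
        TensorProduct.smul_tmul_smul]

lemma map_mulLegs {M' N' : Type u} [AddCommGroup M'] [Module k M'] [AddCommGroup N'] [Module k N']
    (f : M →ₗ[k] M') (g : N →ₗ[k] N') (u : M ⊗[k] H) (w : N ⊗[k] H) :
    (TensorProduct.map f g).rTensor H (mulLegs (u ⊗ₜ[k] w)) =
      mulLegs (f.rTensor H u ⊗ₜ[k] g.rTensor H w) := by
  induction u with
  | zero => simp
  | add a b ha hb => simp only [TensorProduct.add_tmul, map_add, ha, hb]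
  | tmul m a =>
    induction w with
    | zero => simp
    | add a b ha hb => simp only [TensorProduct.tmul_add, map_add, ha, hb]
    | tmul n b => simp

lemma map_tensorAct {M' N' : Type u} [AddCommGroup M'] [Module k M'] [AddCommGroup N']
    [Module k N'] {a : H →ₐ[k] Module.End k M} {b : H →ₐ[k] Module.End k N}
    {a' : H →ₐ[k] Module.End k M'} {b' : H →ₐ[k] Module.End k N'}
    (f : M →ₗ[k] M') (g : N →ₗ[k] N') (hf : ∀ h, f ∘ₗ a h = a' h ∘ₗ f)
    (hg : ∀ h, g ∘ₗ b h = b' h ∘ₗ g) (t : H ⊗[k] H) :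
    TensorProduct.map f g ∘ₗ tensorAct a b t = tensorAct a' b' t ∘ₗ TensorProduct.map f g := by
  induction t with
  | zero => simp
  | add x y hx hy => simp only [map_add, LinearMap.comp_add, LinearMap.add_comp, hx, hy]
  | tmul x y => simp only [tensorAct_tmul, ← TensorProduct.map_comp, hf, hg]

variable {P : Type u} [AddCommGroup P] [Module k P]

lemma assoc_diagAct (a : H →ₐ[k] Module.End k M) (b : H →ₐ[k] Module.End k N)
    (c : H →ₐ[k] Module.End k P) (h : H) :
    (TensorProduct.assoc k M N P).toLinearMap ∘ₗ diagAct (diagAct a b) c h =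
      diagAct a (diagAct b c) h ∘ₗ (TensorProduct.assoc k M N P).toLinearMap := by
  let F : H ⊗[k] (H ⊗[k] H) →ₐ[k] Module.End k (M ⊗[k] (N ⊗[k] P)) :=
    (Module.endTensorEndAlgHom (R := k) (S := k) (A := k)).comp
      (Algebra.TensorProduct.map a (tensorAct b c))
  have h₁ : ∀ t : H ⊗[k] H, (TensorProduct.assoc k M N P).toLinearMap ∘ₗ
      tensorAct (diagAct a b) c t =
      F (TensorProduct.assoc k H H H ((Coalgebra.comul (R := k) (A := H)).rTensor H t)) ∘ₗ
        (TensorProduct.assoc k M N P).toLinearMap := by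
    intro t
    induction t with
    | zero => simp
    | add x y hx hy => simp only [map_add, LinearMap.comp_add, LinearMap.add_comp, hx, hy]
    | tmul x y =>
      have : ∀ s : H ⊗[k] H, (TensorProduct.assoc k M N P).toLinearMap ∘ₗ
          TensorProduct.map (tensorAct a b s) (c y) =
          F (TensorProduct.assoc k H H H (s ⊗ₜ[k] y)) ∘ₗ
            (TensorProduct.assoc k M N P).toLinearMap := by
        intro s
        induction s with
        | zero => simp
        | add p q hp hq =>
          simp only [map_add, TensorProduct.map_add_left, LinearMap.comp_add, LinearMap.add_comp,
            TensorProduct.add_tmul, hp, hq]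
        | tmul p q => exact TensorProduct.ext_threefold fun _ _ _ => rfl
      exact this _
  have h₂ : ∀ t : H ⊗[k] H, tensorAct a (diagAct b c) t =
      F ((Coalgebra.comul (R := k) (A := H)).lTensor H t) := by
    intro t
    induction t with
    | zero => simp
    | add x y hx hy => simp only [map_add, hx, hy]
    | tmul x y => rfl
  change _ ∘ₗ tensorAct (diagAct a b) c (Coalgebra.comul h) =
    tensorAct a (diagAct b c) (Coalgebra.comul h) ∘ₗ _
  rw [h₁, h₂, Coalgebra.coassoc_apply]

lemma assoc_rTensor_mulLegs (u : M ⊗[k] H) (v : N ⊗[k] H) (w : P ⊗[k] H) :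
    (TensorProduct.assoc k M N P).toLinearMap.rTensor H
        (mulLegs (mulLegs (u ⊗ₜ[k] v) ⊗ₜ[k] w)) =
      mulLegs (u ⊗ₜ[k] mulLegs (v ⊗ₜ[k] w)) := by
  induction u with
  | zero => simp
  | add a b ha hb => simp only [TensorProduct.add_tmul, map_add, ha, hb]
  | tmul m a =>
    induction v with
    | zero => simp
    | add a b ha hb => simp only [TensorProduct.add_tmul, TensorProduct.tmul_add, map_add, ha, hb]
    | tmul n b =>
      induction w with
      | zero => simp
      | add a b ha hb => simp only [TensorProduct.tmul_add, map_add, ha, hb]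
      | tmul p c => simp [mul_assoc]

end Data

/-- The tensor product over `k`, with the diagonal action and the diagonal coaction. -/
def tensor (M N : ModComod k H) : ModComod k H where
  carrier := M ⊗[k] N
  act := diagAct M.act N.act
  coact := diagCoact M.coact N.coact
  coassoc := TensorProduct.ext' fun m n => by
    have hM := LinearMap.congr_fun M.coassoc m
    have hN := LinearMap.congr_fun N.coassoc n
    simp only [LinearMap.comp_apply, LinearEquiv.coe_coe] at hM hN ⊢
    rw [diagCoact_tmul, assoc_diagCoact, comul_mulLegs, hM, hN]
  counit := TensorProduct.ext' fun m n => by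
    have hM := LinearMap.congr_fun M.counit m
    have hN := LinearMap.congr_fun N.counit n
    simp only [LinearMap.comp_apply, LinearEquiv.coe_coe] at hM hN ⊢
    rw [diagCoact_tmul, counit_mulLegs, hM, hN]
    rfl

variable (k H) in
/-- The trivial action `h · x = ε(h) x` of `H` on `k`. -/
def trivAct : H →ₐ[k] Module.End k k :=
  (Algebra.ofId k (Module.End k k)).comp (Bialgebra.counitAlgHom k H)

lemma trivAct_apply (h : H) (x : k) :
    trivAct k H h x = Coalgebra.counit (R := k) h * x := rfl

variable (k H) in
/-- The field `k`, with the trivial action `h · x = ε(h) x` and the trivial coaction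
`x ↦ x ⊗ 1`. -/
def unit : ModComod k H where
  carrier := k
  act := trivAct k H
  coact := (TensorProduct.mk k k H).flip 1
  coassoc := by ext; simp [Algebra.TensorProduct.one_def]
  counit := by ext; simp

lemma lid_diagAct {M : Type u} [AddCommGroup M] [Module k M] (a : H →ₐ[k] Module.End k M)
    (h : H) : (TensorProduct.lid k M).toLinearMap ∘ₗ diagAct (trivAct k H) a h =
      a h ∘ₗ (TensorProduct.lid k M).toLinearMap := by
  have h₁ : ∀ t : H ⊗[k] H, (TensorProduct.lid k M).toLinearMap ∘ₗ
      tensorAct (trivAct k H) a t =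
      a (TensorProduct.lid k H ((Coalgebra.counit (R := k) (A := H)).rTensor H t)) ∘ₗ
        (TensorProduct.lid k M).toLinearMap := by
    intro t
    induction t with
    | zero => simp
    | add x y hx hy => simp only [map_add, LinearMap.comp_add, LinearMap.add_comp, hx, hy]
    | tmul x y =>
      refine TensorProduct.ext' fun c m => ?_
      change (Coalgebra.counit x * c) • a y m = a (Coalgebra.counit (R := k) x • y) (c • m)
      rw [map_smul, map_smul, LinearMap.smul_apply, mul_comm, mul_smul]
  refine (h₁ (Coalgebra.comul h)).trans ?_
  rw [Coalgebra.rTensor_counit_comul, TensorProduct.lid_tmul, one_smul]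

lemma rid_diagAct {M : Type u} [AddCommGroup M] [Module k M] (a : H →ₐ[k] Module.End k M)
    (h : H) : (TensorProduct.rid k M).toLinearMap ∘ₗ diagAct a (trivAct k H) h =
      a h ∘ₗ (TensorProduct.rid k M).toLinearMap := by
  have h₁ : ∀ t : H ⊗[k] H, (TensorProduct.rid k M).toLinearMap ∘ₗ
      tensorAct a (trivAct k H) t =
      a (TensorProduct.rid k H ((Coalgebra.counit (R := k) (A := H)).lTensor H t)) ∘ₗ
        (TensorProduct.rid k M).toLinearMap := by
    intro t
    induction t with
    | zero => simp
    | add x y hx hy => simp only [map_add, LinearMap.comp_add, LinearMap.add_comp, hx, hy]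
    | tmul x y =>
      refine TensorProduct.ext' fun m c => ?_
      change (Coalgebra.counit y * c) • a x m = a (Coalgebra.counit (R := k) y • x) (c • m)
      rw [map_smul, map_smul, LinearMap.smul_apply, mul_comm, mul_smul]
  refine (h₁ (Coalgebra.comul h)).trans ?_
  rw [Coalgebra.lTensor_counit_comul, TensorProduct.rid_tmul, one_smul]

/-- A linear isomorphism that is `H`-linear and `H`-colinear is an isomorphism. -/
def isoOfEquiv {M N : ModComod k H} (e : M ≃ₗ[k] N)
    (h₁ : ∀ h : H, e.toLinearMap ∘ₗ M.act h = N.act h ∘ₗ e.toLinearMap)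
    (h₂ : e.toLinearMap.rTensor H ∘ₗ M.coact = N.coact ∘ₗ e.toLinearMap) : M ≅ N where
  hom := ⟨e.toLinearMap, h₁, h₂⟩
  inv := ⟨e.symm.toLinearMap,
    fun h => LinearMap.ext fun n => by
      have := LinearMap.congr_fun (h₁ h) (e.symm n)
      simp only [LinearMap.comp_apply, LinearEquiv.coe_coe, LinearEquiv.apply_symm_apply] at this ⊢
      rw [← this, LinearEquiv.symm_apply_apply],
    LinearMap.ext fun n => by
      have := LinearMap.congr_fun h₂ (e.symm n)
      simp only [LinearMap.comp_apply, LinearEquiv.coe_coe, LinearEquiv.apply_symm_apply] at this ⊢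
      rw [← this, ← LinearMap.comp_apply, ← LinearMap.rTensor_comp, LinearEquiv.symm_comp,
        LinearMap.rTensor_id, LinearMap.id_apply]⟩
  hom_inv_id := hom_ext (by ext; simp)
  inv_hom_id := hom_ext (by ext; simp)

/-- The tensor product of two morphisms. -/
def tensorMap {M N M' N' : ModComod k H} (f : M ⟶ M') (g : N ⟶ N') :
    tensor M N ⟶ tensor M' N' where
  lin := TensorProduct.map f.lin g.lin
  map_act h := map_tensorAct f.lin g.lin f.map_act g.map_act (Coalgebra.comul h)
  map_coact := TensorProduct.ext' fun m n => by
    have hf := LinearMap.congr_fun f.map_coact m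
    have hg := LinearMap.congr_fun g.map_coact n
    simp only [LinearMap.comp_apply] at hf hg
    change (TensorProduct.map f.lin g.lin).rTensor H (mulLegs (M.coact m ⊗ₜ[k] N.coact n)) =
      mulLegs (M'.coact (f.lin m) ⊗ₜ[k] N'.coact (g.lin n))
    rw [map_mulLegs, hf, hg]

instance : MonoidalCategoryStruct (ModComod k H) where
  tensorObj := tensor
  tensorUnit := unit k H
  tensorHom f g := tensorMap f g
  whiskerLeft M _ _ f := tensorMap (𝟙 M) f
  whiskerRight f N := tensorMap f (𝟙 N)
  associator M N P := isoOfEquiv (M := tensor (tensor M N) P) (N := tensor M (tensor N P))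
    (TensorProduct.assoc k M N P) (assoc_diagAct M.act N.act P.act)
    (TensorProduct.ext_threefold fun m n p =>
      assoc_rTensor_mulLegs (M.coact m) (N.coact n) (P.coact p))
  leftUnitor M := isoOfEquiv (M := tensor (unit k H) M) (N := M) (TensorProduct.lid k M)
    (lid_diagAct M.act) (TensorProduct.ext' fun (x : k) m => by
      change (TensorProduct.lid k M).toLinearMap.rTensor H
        (mulLegs ((x ⊗ₜ[k] (1 : H)) ⊗ₜ[k] M.coact m)) = M.coact (x • m)
      rw [map_smul]
      induction M.coact m with
      | zero => simp
      | add a b ha hb => simp only [TensorProduct.tmul_add, map_add, ha, hb, smul_add]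
      | tmul m a => simp [TensorProduct.smul_tmul'])
  rightUnitor M := isoOfEquiv (M := tensor M (unit k H)) (N := M) (TensorProduct.rid k M)
    (rid_diagAct M.act) (TensorProduct.ext' fun m (x : k) => by
      change (TensorProduct.rid k M).toLinearMap.rTensor H
        (mulLegs (M.coact m ⊗ₜ[k] (x ⊗ₜ[k] (1 : H)))) = M.coact (x • m)
      rw [map_smul]
      induction M.coact m with
      | zero => simp
      | add a b ha hb => simp only [TensorProduct.add_tmul, map_add, ha, hb, smul_add]
      | tmul m a => simp [TensorProduct.smul_tmul'])

instance : MonoidalCategory (ModComod k H) :=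
  MonoidalCategory.ofTensorHom
    (id_tensorHom_id := fun _ _ => hom_ext TensorProduct.map_id)
    (id_tensorHom := fun _ _ _ _ => rfl)
    (tensorHom_id := fun _ _ => rfl)
    (tensorHom_comp_tensorHom := fun _ _ _ _ =>
      hom_ext (TensorProduct.map_comp _ _ _ _).symm)
    (associator_naturality := fun _ _ _ => hom_ext (TensorProduct.ext_threefold fun _ _ _ => rfl))
    (leftUnitor_naturality := fun f => hom_ext (TensorProduct.ext' fun x m =>
      (f.lin.map_smul x m).symm))
    (rightUnitor_naturality := fun f => hom_ext (TensorProduct.ext' fun m x =>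
      (f.lin.map_smul x m).symm))
    (pentagon := fun _ _ _ _ => hom_ext (TensorProduct.ext_fourfold fun _ _ _ _ => rfl))
    (triangle := fun _ _ => hom_ext (TensorProduct.ext_threefold fun m (x : k) n =>
      (TensorProduct.smul_tmul x m n).symm))

end ModComod

end ModComod

section Normal

variable {k : Type u} {H : Type v} [Field k] [Ring H] [HopfAlgebra k H]

/-- `M` is a (left-right) normal `(H, R)`-module:
`ν_M(m) ∈ M ⊗ Z(H)` and
`ν_M(h · m) = R⁽²⁾ h₂ R'⁽²⁾ · m₀ ⊗ S(h₁) S(R⁽¹⁾) h₃ R'⁽¹⁾ m₁`.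
The right-hand side of the latter is `ν(h)` applied to `ν_M(m)`, where `H ⊗ H` acts on `M ⊗ H`
by `(a ⊗ b) · (m ⊗ x) = a · m ⊗ b x`. -/
def IsNormal (R : H ⊗[k] H) : ObjectProperty (ModComod k H) := fun M =>
  (∀ m : M, M.coact m ∈ tensorCenter k H M) ∧
  ∀ (h : H) (m : M), M.coact (M.act h m) = Module.endTensorEndAlgHom (R := k) (S := k) (A := k)
    (Algebra.TensorProduct.map M.act (Algebra.lmul k H) (nu R h)) (M.coact m)

/-- The category of normal `(H, R)`-modules; the morphisms are the `H`-linear and `H`-colinear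
maps. -/
abbrev NormalModule (R : H ⊗[k] H) := (IsNormal R).FullSubcategory

/-- The map `M ⊗ N → N ⊗ M`, `m ⊗ n ↦ R⁽²⁾ · n₀ ⊗ R⁽¹⁾ · (n₁ · m)`. -/
def braidMap (R : H ⊗[k] H) (M N : ModComod k H) : M ⊗[k] N →ₗ[k] N ⊗[k] M :=
  ModComod.tensorAct N.act M.act (TensorProduct.comm k H H R) ∘ₗ
    (TensorProduct.lift M.act.toLinearMap).lTensor N ∘ₗ
    (TensorProduct.assoc k N H M).toLinearMap ∘ₗ
    (TensorProduct.comm k M (N ⊗[k] H)).toLinearMap ∘ₗ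
    N.coact.lTensor M

end Normal

end SemiQT

end

/-! Write `R₂₁` for `swap R`. Its inverse is `flipAntipode R`, so the definition of `ν` says that,
for the convolution product of maps `H → H ⊗ H`, `ν` is the unique solution of `(1 ⊗ h₁) ν(h₂) =
R₂₁⁻¹ Δ(h) R₂₁` (`conv_incRight_nu`). Identities for `ν` are proved by cancelling the
convolution-invertible map `h ↦ 1 ⊗ h`.

Normal modules form a full subcategory of the monoidal category `ModComod`, so the monoidal part
reduces to closure. The unit is normal because `(ε ⊗ id)ν = ε` (`counitFst_nu`), and tensor products
are normal because `(Δ ⊗ id)ν(h) = ν(h₁)₁₃ ν(h₂)₂₃` (`conv_inc13_nu_inc23_nu`), where centrality of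
the second leg of `ν` is essential.

The braiding is the insertion `m ⊗ n ↦ n₀ ⊗ n₁ · m` followed by the action of `R₂₁`. Centrality and
compatibility of the coaction with `ν` make the insertion carry the action of `Δ(h)` to that of `(1
⊗ h₁) ν(h₂) = R₂₁⁻¹ Δ(h) R₂₁`; hence the braiding is `H`-linear. The insertion is invertible because
maps `n ⊗ m ↦ n₀ ⊗ φ(n₁)(m)` compose by convolution of the `φ` (`twist_comp_twist`).

For colinearity, both factors are colinear separately. In `n₀ ⊗ Δ(n₁)` both legs of `Δ(n₁)` are
central, so conjugation by `R₂₁` does nothing there and the insertion is colinear. The action of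
`R₂₁` is colinear because `ν` is trivial on either leg of `R` (`rTensor_nu_swap`, `rTensor_nu`);
these two facts rest on `cop_right`, and on `cop_left` with `nu_eq`. The hexagons are the two
coproduct formulas for `R₂₁`, the second one together with `rTensor_nu_swap`. -/

noncomputable section

namespace SemiQT

/-! ### Convolution of linear maps from `H` to an algebra. -/

section Convolution

variable {k H A B : Type*} [Field k] [Ring H] [HopfAlgebra k H] [Ring A] [Algebra k A]
  [Ring B] [Algebra k B]

/-- The convolution product `h ↦ φ(h₁) ψ(h₂)`. -/
def conv (φ ψ : H →ₗ[k] A) : H →ₗ[k] A :=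
  LinearMap.mul' k A ∘ₗ TensorProduct.map φ ψ ∘ₗ Coalgebra.comul

variable (k H A) in
/-- The unit `h ↦ ε(h) 1` of the convolution product. -/
def convUnit : H →ₗ[k] A := Algebra.linearMap k A ∘ₗ Coalgebra.counit

/-- `conv` unfolds to the product of the convolution ring `WithConv`, from which associativity and
the unit law are transported. -/
lemma conv_assoc (φ ψ χ : H →ₗ[k] A) : conv (conv φ ψ) χ = conv φ (conv ψ χ) :=
  congrArg WithConv.ofConv
    (mul_assoc (WithConv.toConv φ) (WithConv.toConv ψ) (WithConv.toConv χ))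

lemma convUnit_conv (φ : H →ₗ[k] A) : conv (convUnit k H A) φ = φ :=
  congrArg WithConv.ofConv (one_mul (WithConv.toConv φ))

lemma algHom_comp_conv (p : A →ₐ[k] B) (φ ψ : H →ₗ[k] A) :
    p.toLinearMap ∘ₗ conv φ ψ = conv (p.toLinearMap ∘ₗ φ) (p.toLinearMap ∘ₗ ψ) :=
  LinearMap.algHom_comp_convMul_distrib p (WithConv.toConv φ) (WithConv.toConv ψ)

lemma algHom_comp_convUnit (p : A →ₐ[k] B) :
    p.toLinearMap ∘ₗ convUnit k H A = convUnit k H B := by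
  ext h
  simp [convUnit]

/-- The convolution inverse `j ∘ S` of an algebra homomorphism `j`. -/
def antipodeComp (j : H →ₐ[k] A) : H →ₗ[k] A := j.toLinearMap ∘ₗ HopfAlgebra.antipode k

lemma conv_antipodeComp (j : H →ₐ[k] A) :
    conv j.toLinearMap (antipodeComp j) = convUnit k H A := by
  have h : conv (LinearMap.id : H →ₗ[k] H) (HopfAlgebra.antipode k) = convUnit k H H :=
    congrArg WithConv.ofConv LinearMap.id_mul_antipode
  simpa only [algHom_comp_conv, algHom_comp_convUnit, LinearMap.comp_id, antipodeComp] using congrArg (j.toLinearMap ∘ₗ ·) h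

lemma antipodeComp_conv (j : H →ₐ[k] A) :
    conv (antipodeComp j) j.toLinearMap = convUnit k H A := by
  have h : conv (HopfAlgebra.antipode k) (LinearMap.id : H →ₗ[k] H) = convUnit k H H :=
    congrArg WithConv.ofConv LinearMap.antipode_mul_id
  simpa only [algHom_comp_conv, algHom_comp_convUnit, LinearMap.comp_id, antipodeComp] using congrArg (j.toLinearMap ∘ₗ ·) h

lemma algHom_comp_antipodeComp (p : A →ₐ[k] B) (j : H →ₐ[k] A) :
    p.toLinearMap ∘ₗ antipodeComp j = antipodeComp (p.comp j) := rfl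

/-- An algebra homomorphism is convolution-invertible. This cancellation and the next one are what
allow passing between `ν` and `h ↦ R₂₁⁻¹ Δ(h) R₂₁`. -/
lemma conv_antipodeComp_conv (j : H →ₐ[k] A) (φ : H →ₗ[k] A) :
    conv j.toLinearMap (conv (antipodeComp j) φ) = φ := by
  rw [← conv_assoc, conv_antipodeComp, convUnit_conv]

lemma antipodeComp_conv_conv (j : H →ₐ[k] A) (φ : H →ₗ[k] A) :
    conv (antipodeComp j) (conv j.toLinearMap φ) = φ := by
  rw [← conv_assoc, antipodeComp_conv, convUnit_conv]

/-- Convolution commutes with multiplying the left factor by a constant on the left. -/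
lemma mulLeft_comp_conv (a : A) (φ ψ : H →ₗ[k] A) :
    LinearMap.mulLeft k a ∘ₗ conv φ ψ = conv (LinearMap.mulLeft k a ∘ₗ φ) ψ := by
  ext h
  simp only [conv, LinearMap.comp_apply]
  induction Coalgebra.comul (R := k) h with
  | zero => simp
  | add x y hx hy => simp only [map_add, hx, hy]
  | tmul x y => simp [mul_assoc]

/-- Convolution commutes with multiplying the right factor by a constant on the right. -/
lemma mulRight_comp_conv (a : A) (φ ψ : H →ₗ[k] A) :
    LinearMap.mulRight k a ∘ₗ conv φ ψ = conv φ (LinearMap.mulRight k a ∘ₗ ψ) := by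
  ext h
  simp only [conv, LinearMap.comp_apply]
  induction Coalgebra.comul (R := k) h with
  | zero => simp
  | add x y hx hy => simp only [map_add, hx, hy]
  | tmul x y => simp [mul_assoc]

/-- A constant in the middle of a convolution product can be moved from one factor to the other. -/
lemma conv_mulRight_comp (a : A) (φ ψ : H →ₗ[k] A) :
    conv (LinearMap.mulRight k a ∘ₗ φ) ψ = conv φ (LinearMap.mulLeft k a ∘ₗ ψ) := by
  ext h
  simp only [conv, LinearMap.comp_apply]
  induction Coalgebra.comul (R := k) h with
  | zero => simp
  | add x y hx hy => simp only [map_add, hx, hy]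
  | tmul x y => simp [mul_assoc]

end Convolution

/-! ### The axioms for `R`, rewritten in `(H ⊗ H) ⊗ H` for `R` and `R₂₁`. -/

section Legs

variable {k : Type u} {H : Type v} [Field k] [Ring H] [HopfAlgebra k H]

variable (k H) in
/-- `a ⊗ b ↦ (a ⊗ b) ⊗ 1`. -/
def inc12 : H ⊗[k] H →ₐ[k] (H ⊗[k] H) ⊗[k] H := Algebra.TensorProduct.includeLeft

variable (k H) in
/-- `a ⊗ b ↦ (a ⊗ 1) ⊗ b`. -/
def inc13 : H ⊗[k] H →ₐ[k] (H ⊗[k] H) ⊗[k] H :=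
  Algebra.TensorProduct.map Algebra.TensorProduct.includeLeft (AlgHom.id k H)

variable (k H) in
/-- `a ⊗ b ↦ (1 ⊗ a) ⊗ b`. -/
def inc23 : H ⊗[k] H →ₐ[k] (H ⊗[k] H) ⊗[k] H :=
  Algebra.TensorProduct.map Algebra.TensorProduct.includeRight (AlgHom.id k H)

lemma inc12_apply (x : H ⊗[k] H) : inc12 k H x = x ⊗ₜ[k] (1 : H) := rfl

lemma inc13_tmul (a b : H) : inc13 k H (a ⊗ₜ[k] b) = (a ⊗ₜ[k] (1 : H)) ⊗ₜ[k] b := rfl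

lemma inc23_tmul (a b : H) : inc23 k H (a ⊗ₜ[k] b) = ((1 : H) ⊗ₜ[k] a) ⊗ₜ[k] b := rfl

variable (k H) in
/-- `h ↦ h₂ ⊗ h₁`. -/
def comulCop : H →ₗ[k] H ⊗[k] H :=
  (TensorProduct.comm k H H).toLinearMap ∘ₗ Coalgebra.comul

variable (k H) in
/-- `h ↦ 1 ⊗ h`. -/
def incRight : H →ₐ[k] H ⊗[k] H := Algebra.TensorProduct.includeRight

variable (k H) in
/-- `h ↦ h ⊗ 1`. -/
def incLeft : H →ₐ[k] H ⊗[k] H := Algebra.TensorProduct.includeLeft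

lemma conv_incLeft_incRight :
    conv (incLeft k H).toLinearMap (incRight k H).toLinearMap = Coalgebra.comul := by
  ext h
  simp only [conv, LinearMap.comp_apply]
  induction Coalgebra.comul (R := k) h with
  | zero => simp
  | add x y hx hy => simp only [map_add, hx, hy]
  | tmul x y => simp [incLeft, incRight]

lemma conv_incRight_incLeft :
    conv (incRight k H).toLinearMap (incLeft k H).toLinearMap = comulCop k H := by
  ext h
  simp only [conv, comulCop, LinearMap.comp_apply]
  induction Coalgebra.comul (R := k) h with
  | zero => simp
  | add x y hx hy => simp only [map_add, hx, hy]
  | tmul x y => simp [incLeft, incRight]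

/-- The element `R⁽²⁾ ⊗ R⁽¹⁾`. -/
abbrev swap (R : H ⊗[k] H) : H ⊗[k] H := TensorProduct.comm k H H R

namespace IsSemiquasitriangular

variable {R : H ⊗[k] H} (hR : IsSemiquasitriangular R)

include hR

/-- `R⁽¹⁾₁ ⊗ R⁽¹⁾₂ ⊗ R⁽²⁾ = R₁₃ R₂₃`. -/
lemma rTensor_comul : (Coalgebra.comul (R := k) (A := H)).rTensor H R =
    inc13 k H R * inc23 k H R := by
  let Φ := (Algebra.TensorProduct.assoc k k k H H H).symm
  have h₁ : ∀ X : H ⊗[k] H, Φ (leg13 X) = inc13 k H X := by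
    intro X
    induction X with
    | zero => simp [leg13]
    | add x y hx hy => simp only [leg13, map_add] at hx hy ⊢; rw [hx, hy]
    | tmul x y => rfl
  have h₂ : ∀ X : H ⊗[k] H, Φ (leg23 X) = inc23 k H X := by
    intro X
    induction X with
    | zero => simp [leg23]
    | add x y hx hy => simp only [leg23, map_add, tmul_add] at hx hy ⊢; rw [hx, hy]
    | tmul x y => rfl
  rw [← h₁, ← h₂, ← map_mul, ← hR.comul_left]
  exact ((TensorProduct.assoc k H H H).symm_apply_apply _).symm

/-- `R⁽²⁾₁ ⊗ R⁽²⁾₂ ⊗ R⁽¹⁾ = (R₂₁)₂₃ (R₂₁)₁₃`. -/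
lemma rTensor_comul_swap : (Coalgebra.comul (R := k) (A := H)).rTensor H (swap R) =
    inc23 k H (swap R) * inc13 k H (swap R) := by
  let Φ := Algebra.TensorProduct.comm k H (H ⊗[k] H)
  have h₁ : ∀ X : H ⊗[k] H, Φ (leg13 X) = inc23 k H (swap X) := by
    intro X
    induction X with
    | zero => simp [leg13]
    | add x y hx hy => simp only [leg13, map_add] at hx hy ⊢; rw [hx, hy]
    | tmul x y => rfl
  have h₂ : ∀ X : H ⊗[k] H, Φ (leg12 X) = inc13 k H (swap X) := by
    intro X
    induction X with
    | zero => simp [leg12]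
    | add x y hx hy => simp only [leg12, map_add, add_tmul] at hx hy ⊢; rw [hx, hy]
    | tmul x y => rfl
  have h₃ : ∀ X : H ⊗[k] H, (Coalgebra.comul (R := k) (A := H)).rTensor H (swap X) =
      Φ (comulRight X) := by
    intro X
    induction X with
    | zero => simp [comulRight]
    | add x y hx hy => simp only [comulRight, map_add] at hx hy ⊢; rw [hx, hy]
    | tmul x y => rfl
  rw [← h₁, ← h₂, ← map_mul, ← hR.comul_right, h₃]

/-- `R⁽²⁾ ⊗ R⁽¹⁾₁ ⊗ R⁽¹⁾₂ = (R₂₁)₁₂ (R₂₁)₁₃`. -/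
lemma lTensor_comul_swap :
    (TensorProduct.assoc k H H H).symm ((Coalgebra.comul (R := k) (A := H)).lTensor H (swap R)) =
      inc12 k H (swap R) * inc13 k H (swap R) := by
  let Φ := ((Algebra.TensorProduct.assoc k k k H H H).symm.trans
    (Algebra.TensorProduct.comm k (H ⊗[k] H) H)).trans
      (Algebra.TensorProduct.assoc k k k H H H).symm
  have h₁ : ∀ X : H ⊗[k] H, Φ (leg13 X) = inc12 k H (swap X) := by
    intro X
    induction X with
    | zero => simp [leg13]
    | add x y hx hy => simp only [leg13, map_add] at hx hy ⊢; rw [hx, hy]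
    | tmul x y => rfl
  have h₂ : ∀ X : H ⊗[k] H, Φ (leg23 X) = inc13 k H (swap X) := by
    intro X
    induction X with
    | zero => simp [leg23]
    | add x y hx hy => simp only [leg23, map_add, tmul_add] at hx hy ⊢; rw [hx, hy]
    | tmul x y => rfl
  have h₃ : ∀ X : H ⊗[k] H, (TensorProduct.assoc k H H H).symm
      ((Coalgebra.comul (R := k) (A := H)).lTensor H (swap X)) = Φ (comulLeft X) := by
    intro X
    induction X with
    | zero => simp [comulLeft]
    | add x y hx hy => simp only [comulLeft, map_add] at hx hy ⊢; rw [hx, hy]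
    | tmul x y =>
      change _ = (TensorProduct.assoc k H H H).symm (TensorProduct.comm k (H ⊗[k] H) H
        ((TensorProduct.assoc k H H H).symm (TensorProduct.assoc k H H H _)))
      rw [LinearEquiv.symm_apply_apply]
      rfl
  rw [← h₁, ← h₂, ← map_mul, ← hR.comul_left, h₃]

/-- This is the axiom `cop_right` with its legs permuted: on the leg `R⁽²⁾`, conjugation by `R₂₁`
exchanges `Δ` and `Δᶜᵒᵖ`. -/
lemma rTensor_comul_swap_mul :
    (Coalgebra.comul (R := k) (A := H)).rTensor H (swap R) * inc12 k H (swap R) =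
      inc12 k H (swap R) * (comulCop k H).rTensor H (swap R) := by
  let Φ := (Algebra.TensorProduct.comm k H (H ⊗[k] H)).trans
    (Algebra.TensorProduct.congr (Algebra.TensorProduct.comm k H H) (AlgEquiv.refl (A₁ := H)))
  have h₁ : ∀ X : H ⊗[k] H, Φ (leg23 X) = inc12 k H (swap X) := by
    intro X
    induction X with
    | zero => simp [leg23]
    | add x y hx hy => simp only [leg23, map_add, tmul_add] at hx hy ⊢; rw [hx, hy]
    | tmul x y => rfl
  have h₂ : ∀ X : H ⊗[k] H, Φ (comulRight X) = (comulCop k H).rTensor H (swap X) := by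
    intro X
    induction X with
    | zero => simp [comulRight]
    | add x y hx hy => simp only [comulRight, map_add] at hx hy ⊢; rw [hx, hy]
    | tmul x y => rfl
  have h₃ : ∀ X : H ⊗[k] H, Φ (comulCopRight X) =
      (Coalgebra.comul (R := k) (A := H)).rTensor H (swap X) := by
    intro X
    induction X with
    | zero => simp [comulCopRight]
    | add x y hx hy => simp only [comulCopRight, map_add] at hx hy ⊢; rw [hx, hy]
    | tmul x y =>
      change TensorProduct.comm k H H (TensorProduct.comm k H H (Coalgebra.comul y)) ⊗ₜ[k] x = _
      exact congrArg (· ⊗ₜ[k] x) ((TensorProduct.comm k H H).symm_apply_apply _)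
  rw [← h₁, ← h₂, ← h₃, ← map_mul, ← map_mul, hR.cop_right]

/-- This is the axiom `cop_left` with the tensor factors rebracketed. -/
lemma rTensor_comulCop_mul :
    (comulCop k H).rTensor H R * inc12 k H R =
      inc12 k H R * (Coalgebra.comul (R := k) (A := H)).rTensor H R := by
  let Φ := (Algebra.TensorProduct.assoc k k k H H H)
  have h₁ : ∀ X : H ⊗[k] H, Φ (inc12 k H X) = leg12 X := fun _ => rfl
  have h₂ : ∀ X : H ⊗[k] H,
      Φ ((Coalgebra.comul (R := k) (A := H)).rTensor H X) = comulLeft X := fun _ => rfl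
  have h₃ : ∀ X : H ⊗[k] H, Φ ((comulCop k H).rTensor H X) = comulCopLeft X := fun _ => rfl
  apply Φ.injective
  rw [map_mul, map_mul, h₁, h₂, h₃, hR.cop_left]

end IsSemiquasitriangular

end Legs

end SemiQT

namespace SemiQT

/-! ### The inverse of `R`, and the values of `ν` on the legs of `R`. -/

section Structure

variable {k : Type u} {H : Type v} [Field k] [Ring H] [HopfAlgebra k H]

lemma tensorCenter_induction {M : Type*} [AddCommGroup M] [Module k M] {p : M ⊗[k] H → Prop}
    (zero : p 0) (add : ∀ u w, p u → p w → p (u + w))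
    (tmul : ∀ m, ∀ z ∈ Subalgebra.center k H, p (m ⊗ₜ[k] z)) {u : M ⊗[k] H}
    (hu : u ∈ tensorCenter k H M) : p u := by
  obtain ⟨t, rfl⟩ := hu
  induction t with
  | zero => simpa using zero
  | add x y hx hy => rw [map_add]; exact add _ _ hx hy
  | tmul m z => exact tmul m z.1 z.2

lemma tmul_mem_tensorCenter {M : Type*} [AddCommGroup M] [Module k M] (m : M) {z : H}
    (hz : z ∈ Subalgebra.center k H) : m ⊗ₜ[k] z ∈ tensorCenter k H M :=
  ⟨m ⊗ₜ[k] (⟨z, hz⟩ : Subalgebra.center k H), rfl⟩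

variable (k H) in
/-- `a ⊗ b ↦ ε(a) b`. -/
def counitFst : H ⊗[k] H →ₐ[k] H :=
  (Algebra.TensorProduct.lid k H).toAlgHom.comp
    (Algebra.TensorProduct.map (Bialgebra.counitAlgHom k H) (AlgHom.id k H))

lemma counitFst_tmul (a b : H) :
    counitFst k H (a ⊗ₜ[k] b) = Coalgebra.counit (R := k) a • b := rfl

lemma counitFst_comul (h : H) : counitFst k H (Coalgebra.comul h) = h :=
  (congrArg (TensorProduct.lid k H) (Coalgebra.rTensor_counit_comul h)).trans (by simp)

variable (k H) in
/-- `(a ⊗ b) ⊗ c ↦ ε(a) b ⊗ c`. -/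
def counitFst₃ : (H ⊗[k] H) ⊗[k] H →ₐ[k] H ⊗[k] H :=
  Algebra.TensorProduct.map (counitFst k H) (AlgHom.id k H)

lemma counitFst₃_inc13 (X : H ⊗[k] H) :
    counitFst₃ k H (inc13 k H X) = 1 ⊗ₜ[k] counitFst k H X := by
  induction X with
  | zero => simp
  | add x y hx hy => simp only [map_add, hx, hy, tmul_add]
  | tmul a b =>
    rw [inc13_tmul, counitFst_tmul, tmul_smul, smul_tmul']
    rfl

lemma counitFst₃_inc23 (X : H ⊗[k] H) : counitFst₃ k H (inc23 k H X) = X := by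
  induction X with
  | zero => simp
  | add x y hx hy => simp only [map_add, hx, hy]
  | tmul a b =>
    change (Coalgebra.counit (R := k) (1 : H) • a) ⊗ₜ[k] b = _
    rw [Bialgebra.counit_one, one_smul]

lemma counitFst₃_rTensor_comul (X : H ⊗[k] H) :
    counitFst₃ k H ((Coalgebra.comul (R := k) (A := H)).rTensor H X) = X := by
  induction X with
  | zero => simp
  | add x y hx hy => simp only [map_add, hx, hy]
  | tmul a b => exact congrArg (· ⊗ₜ[k] b) (counitFst_comul a)

lemma counitFst_one_tmul (x : H) : counitFst k H ((1 : H) ⊗ₜ[k] x) = x := by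
  rw [counitFst_tmul, Bialgebra.counit_one, one_smul]

lemma rTensor_convUnit (X : H ⊗[k] H) (A : Type*) [Ring A] [Algebra k A] :
    (convUnit k H A).rTensor H X = 1 ⊗ₜ[k] counitFst k H X := by
  induction X with
  | zero => simp
  | add x y hx hy => simp only [map_add, hx, hy, tmul_add]
  | tmul a b =>
    rw [counitFst_tmul, tmul_smul, smul_tmul', ← Algebra.algebraMap_eq_smul_one]
    rfl

section Conv

variable {A : Type*} [Ring A] [Algebra k A]

lemma rTensor_conv (φ ψ : H →ₗ[k] A) (X : H ⊗[k] H) :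
    (conv φ ψ).rTensor H X = (LinearMap.mul' k A ∘ₗ TensorProduct.map φ ψ).rTensor H
      ((Coalgebra.comul (R := k) (A := H)).rTensor H X) := by
  rw [← LinearMap.comp_apply, ← LinearMap.rTensor_comp]
  rfl

/-- Since `(Δ ⊗ id)(R) = R₁₃ R₂₃`, taking `X = Y = R` shows that `φ ↦ (φ ⊗ id)(R)` turns convolution
into multiplication. -/
lemma rTensor_mul_inc13_inc23 (φ ψ : H →ₗ[k] A) (X Y : H ⊗[k] H) :
    (LinearMap.mul' k A ∘ₗ TensorProduct.map φ ψ).rTensor H (inc13 k H X * inc23 k H Y) =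
      φ.rTensor H X * ψ.rTensor H Y := by
  induction X with
  | zero => simp
  | add x y hx hy => simp only [map_add, add_mul, hx, hy]
  | tmul a b =>
    induction Y with
    | zero => simp
    | add x y hx hy => simp only [map_add, mul_add, hx, hy]
    | tmul c d => simp [inc13_tmul, inc23_tmul]

/-- For `R₂₁` the coproduct formula has its factors in the order `₂₃`, `₁₃`, so the last legs
multiply in the opposite order and `φ ↦ (φ ⊗ id)(R₂₁)` is not multiplicative. It still holds that
the right factor of a convolution matters only through its value on `R₂₁`. -/
lemma rTensor_mul_inc23_inc13_congr (φ : H →ₗ[k] A) {ψ χ : H →ₗ[k] A} {Y : H ⊗[k] H}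
    (h : ψ.rTensor H Y = χ.rTensor H Y) (X : H ⊗[k] H) :
    (LinearMap.mul' k A ∘ₗ TensorProduct.map φ ψ).rTensor H (inc23 k H Y * inc13 k H X) =
      (LinearMap.mul' k A ∘ₗ TensorProduct.map φ χ).rTensor H (inc23 k H Y * inc13 k H X) := by
  induction X with
  | zero => simp
  | add x y hx hy => simp only [map_add, mul_add, hx, hy]
  | tmul a b =>
    have key : ∀ (ψ : H →ₗ[k] A) (Y : H ⊗[k] H),
        (LinearMap.mul' k A ∘ₗ TensorProduct.map φ ψ).rTensor H
          (inc23 k H Y * inc13 k H (a ⊗ₜ[k] b)) =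
        TensorProduct.map (LinearMap.mulLeft k (φ a)) (LinearMap.mulRight k b)
          (ψ.rTensor H Y) := by
      intro ψ Y
      induction Y with
      | zero => simp
      | add x y hx hy => simp only [map_add, add_mul, hx, hy]
      | tmul c d => simp [inc13_tmul, inc23_tmul]
    rw [key, key, h]

end Conv

/-- The map `h ↦ (R⁽²⁾ ⊗ S(R⁽¹⁾)) * (h₁ ⊗ h₂) * (R'⁽²⁾ ⊗ R'⁽¹⁾)`. -/
def conjComul (R : H ⊗[k] H) : H →ₗ[k] H ⊗[k] H :=
  LinearMap.mulLeft k (flipAntipode R) ∘ₗ LinearMap.mulRight k (swap R) ∘ₗ Coalgebra.comul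

lemma conjComul_apply (R : H ⊗[k] H) (h : H) :
    conjComul R h = flipAntipode R * (Coalgebra.comul h * swap R) := rfl

lemma nu_eq_conv (R : H ⊗[k] H) :
    nu R = conv (antipodeComp (incRight k H)) (conjComul R) := rfl

/-- The antipode in `ν` is the convolution inverse of `h ↦ 1 ⊗ h` and cancels. This relation is the
working form of the definition of `ν`. -/
lemma conv_incRight_nu (R : H ⊗[k] H) :
    conv (incRight k H).toLinearMap (nu R) = conjComul R := by
  rw [nu_eq_conv, conv_antipodeComp_conv]

lemma sandwich_tmul (X : H ⊗[k] H) (a b : H) : sandwich X (a ⊗ₜ[k] b) =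
    (1 ⊗ₜ[k] HopfAlgebra.antipode k b) * X * (a ⊗ₜ[k] 1) := rfl

/-- The map `X ↦ (1 ⊗ S(R⁽²⁾)) * X * (R⁽¹⁾ ⊗ 1)`. -/
def sandwichRight (R : H ⊗[k] H) : H ⊗[k] H →ₗ[k] H ⊗[k] H where
  toFun X := sandwich X R
  map_add' X Y := by
    induction R with
    | zero => simp
    | add x y hx hy => simp only [map_add, hx, hy]; abel
    | tmul a b => simp only [sandwich_tmul, mul_add, add_mul]
  map_smul' c X := by
    induction R with
    | zero => simp
    | add x y hx hy => simp only [map_add, hx, hy, smul_add]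
    | tmul a b => simp only [sandwich_tmul, mul_smul_comm, smul_mul_assoc, RingHom.id_apply]

lemma sandwichRight_apply (R X : H ⊗[k] H) : sandwichRight R X = sandwich X R := rfl

lemma sandwichRight_mul (R : H ⊗[k] H) (h : H) (X : H ⊗[k] H) :
    sandwichRight R (incLeft k H h * X) = incLeft k H h * sandwichRight R X := by
  rw [sandwichRight_apply, sandwichRight_apply]
  induction R with
  | zero => simp
  | add x y hx hy => simp only [map_add, mul_add, hx, hy]
  | tmul a b =>
    have : ((1 : H) ⊗ₜ[k] HopfAlgebra.antipode k b) * incLeft k H h =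
        incLeft k H h * (1 ⊗ₜ[k] HopfAlgebra.antipode k b) := by simp [incLeft]
    simp only [sandwich_tmul, ← mul_assoc, this]

/-- For `X = Y = R` the argument on the right is `(Δ ⊗ id)(R₂₁)`, so that the antipode axiom becomes
applicable. -/
lemma sandwich_eq (X Y : H ⊗[k] H) :
    sandwich X Y = TensorProduct.comm k H H
      ((LinearMap.mul' k H ∘ₗ TensorProduct.map (HopfAlgebra.antipode k) LinearMap.id).rTensor H
        (inc23 k H (swap X) * inc13 k H (swap Y))) := by
  induction X with
  | zero =>
    rw [← sandwichRight_apply]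
    simp
  | add x y hx hy =>
    rw [← sandwichRight_apply, map_add, sandwichRight_apply, sandwichRight_apply]
    simp only [map_add, add_mul, hx, hy]
  | tmul a b =>
    induction Y with
    | zero => simp [swap]
    | add x y hx hy => simp only [map_add, mul_add, hx, hy]
    | tmul c d => simp [sandwich_tmul, inc13_tmul, inc23_tmul]

namespace IsSemiquasitriangular

variable {R : H ⊗[k] H} (hR : IsSemiquasitriangular R)

include hR

/-- Applying `ε` to the first leg of `(Δ ⊗ id)(R) = R₁₃ R₂₃` gives `R = (1 ⊗ ε(R⁽¹⁾)R⁽²⁾) R`, and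
the invertible `R` cancels. -/
lemma counitFst_eq_one : counitFst k H R = 1 := by
  have h := congrArg (counitFst₃ k H) hR.rTensor_comul
  rw [map_mul, counitFst₃_rTensor_comul, counitFst₃_inc13, counitFst₃_inc23] at h
  have h' := congrArg (counitFst k H) (hR.isUnit.mul_eq_right.1 h.symm)
  rwa [counitFst_one_tmul, map_one] at h'

lemma isUnit_swap : IsUnit (swap R) :=
  hR.isUnit.map (Algebra.TensorProduct.comm k H H)

lemma counitFst_swap : counitFst k H (swap R) = 1 := by
  have h := congrArg (counitFst₃ k H) hR.rTensor_comul_swap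
  rw [map_mul, counitFst₃_rTensor_comul, counitFst₃_inc13, counitFst₃_inc23] at h
  have h' := congrArg (counitFst k H) (hR.isUnit_swap.mul_eq_left.1 h.symm)
  rwa [counitFst_one_tmul, map_one] at h'

/-- By multiplicativity of `φ ↦ (φ ⊗ id)(R)`, the left side is the value at `R` of `id * S = ε`, and
`(ε ⊗ id)(R) = 1`. -/
lemma mul_rTensor_antipode : R * (HopfAlgebra.antipode k (A := H)).rTensor H R = 1 := by
  have h := rTensor_mul_inc13_inc23 LinearMap.id (HopfAlgebra.antipode k (A := H)) R R
  rw [← hR.rTensor_comul, ← rTensor_conv, LinearMap.rTensor_id, LinearMap.id_apply] at h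
  rw [← h]
  have h' : conv (LinearMap.id : H →ₗ[k] H) (HopfAlgebra.antipode k) = convUnit k H H :=
    conv_antipodeComp (AlgHom.id k H)
  rw [h', rTensor_convUnit, hR.counitFst_eq_one]
  rfl

lemma rTensor_antipode_mul : (HopfAlgebra.antipode k (A := H)).rTensor H R * R = 1 := by
  obtain ⟨r, hr⟩ := hR.isUnit
  have h := hR.mul_rTensor_antipode
  rw [← hr] at h
  rw [← hr, ← Units.inv_eq_of_mul_eq_one_right h, Units.inv_mul]

lemma swap_mul_flipAntipode : swap R * flipAntipode R = 1 := by
  have := congrArg (Algebra.TensorProduct.comm k H H) hR.mul_rTensor_antipode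
  rwa [map_mul, map_one] at this

lemma flipAntipode_mul_swap : flipAntipode R * swap R = 1 := by
  have := congrArg (Algebra.TensorProduct.comm k H H) hR.rTensor_antipode_mul
  rwa [map_mul, map_one] at this

lemma counitFst_flipAntipode : counitFst k H (flipAntipode R) = 1 := by
  have := congrArg (counitFst k H) hR.swap_mul_flipAntipode
  rwa [map_mul, hR.counitFst_swap, one_mul, map_one] at this

/-- `ν(R⁽²⁾) ⊗ R⁽¹⁾ = R⁽²⁾ ⊗ 1 ⊗ R⁽¹⁾`. -/
lemma rTensor_nu_swap : (nu R).rTensor H (swap R) = inc13 k H (swap R) := by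
  have h₁ : ∀ X : H ⊗[k] H, (conjComul R).rTensor H X =
      inc12 k H (flipAntipode R) *
        ((Coalgebra.comul (R := k) (A := H)).rTensor H X * inc12 k H (swap R)) := by
    intro X
    induction X with
    | zero => simp
    | add x y hx hy => simp only [map_add, add_mul, mul_add, hx, hy]
    | tmul a b => simp [inc12_apply, conjComul_apply]
  -- On `R⁽²⁾`, `cop_right` turns `R₂₁⁻¹ Δ R₂₁` into `Δᶜᵒᵖ`, the convolution of `h ↦ 1 ⊗ h` with `h
  -- ↦ h ⊗ 1`. Its left factor then cancels against the antipode factor of `ν`.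
  have h₂ : (conjComul R).rTensor H (swap R) = (conv (incRight k H).toLinearMap
      (incLeft k H).toLinearMap).rTensor H (swap R) := by
    rw [h₁, hR.rTensor_comul_swap_mul, ← mul_assoc, ← map_mul, hR.flipAntipode_mul_swap, map_one,
      one_mul, conv_incRight_incLeft]
  rw [nu_eq_conv, rTensor_conv, hR.rTensor_comul_swap, rTensor_mul_inc23_inc13_congr _ h₂,
    ← hR.rTensor_comul_swap, ← rTensor_conv, antipodeComp_conv_conv]
  rfl

/-- The element is `R⁽¹⁾R'⁽¹⁾ ⊗ S(R'⁽²⁾)R⁽²⁾`; by the formula for `(id ⊗ Δ)(R)` it equals `R⁽¹⁾ ⊗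
S(R⁽²⁾₁)R⁽²⁾₂ = R⁽¹⁾ ⊗ ε(R⁽²⁾)1 = 1`. -/
lemma sandwich_self : sandwich R R = 1 := by
  have h : conv (HopfAlgebra.antipode k) (LinearMap.id : H →ₗ[k] H) = convUnit k H H :=
    antipodeComp_conv (AlgHom.id k H)
  rw [sandwich_eq, ← hR.rTensor_comul_swap, ← rTensor_conv, h, rTensor_convUnit, hR.counitFst_swap]
  rfl

/-- `ν(R⁽¹⁾) ⊗ R⁽²⁾ = R⁽¹⁾ ⊗ 1 ⊗ R⁽²⁾`. -/
lemma rTensor_nu : (nu R).rTensor H R = inc13 k H R := by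
  let j := (incRight k H)
  let i := (incLeft k H).toLinearMap
  let G : H →ₗ[k] H ⊗[k] H := LinearMap.mulLeft k R ∘ₗ Coalgebra.comul
  -- The axiom `nu_eq` is needed here: in this second expression for `ν` it is `R Δ(h)` that occurs,
  -- to which `cop_left` applies.
  have hnu : nu R = sandwichRight R ∘ₗ conv (antipodeComp j) G := LinearMap.ext hR.nu_eq
  -- On the leg `R⁽¹⁾`, `cop_left` gives `R Δ = Δᶜᵒᵖ R`.
  have hG : G.rTensor H R = (conv j.toLinearMap (LinearMap.mulRight k R ∘ₗ i)).rTensor H R := by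
    have h₁ : ∀ X : H ⊗[k] H, G.rTensor H X = inc12 k H R *
        (Coalgebra.comul (R := k) (A := H)).rTensor H X := by
      intro X
      induction X with
      | zero => simp
      | add x y hx hy => simp only [map_add, mul_add, hx, hy]
      | tmul a b => simp [inc12_apply, G]
    have h₂ : ∀ X : H ⊗[k] H, (LinearMap.mulRight k R ∘ₗ comulCop k H).rTensor H X =
        (comulCop k H).rTensor H X * inc12 k H R := by
      intro X
      induction X with
      | zero => simp
      | add x y hx hy => simp only [map_add, add_mul, hx, hy]
      | tmul a b => simp [inc12_apply]
    rw [← mulRight_comp_conv, conv_incRight_incLeft, h₁, h₂, hR.rTensor_comulCop_mul]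
  -- The `R` left over after cancelling the antipode is absorbed by the sandwich, through `sandwich
  -- R R = 1`.
  have hW : sandwichRight R ∘ₗ (LinearMap.mulRight k R ∘ₗ i) = i := by
    ext h
    change sandwichRight R (incLeft k H h * R) = _
    rw [sandwichRight_mul]
    rw [sandwichRight_apply, hR.sandwich_self, mul_one]
    rfl
  rw [hnu, LinearMap.rTensor_comp, LinearMap.comp_apply, rTensor_conv, hR.rTensor_comul,
    rTensor_mul_inc13_inc23, hG, ← rTensor_mul_inc13_inc23, ← hR.rTensor_comul, ← rTensor_conv,
    antipodeComp_conv_conv, ← LinearMap.comp_apply, ← LinearMap.rTensor_comp, hW]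
  rfl

/-- Under `ε ⊗ id` both `R₂₁` and its inverse become `1`, which leaves `S(h₁)h₂ = ε(h)`. This is the
normality of the unit object. -/
lemma counitFst_nu (h : H) :
    counitFst k H (nu R h) = algebraMap k H (Coalgebra.counit (R := k) h) := by
  have h₁ : (counitFst k H).toLinearMap ∘ₗ conjComul R = LinearMap.id := by
    ext x
    change counitFst k H (conjComul R x) = x
    rw [conjComul_apply, map_mul, map_mul, hR.counitFst_flipAntipode, hR.counitFst_swap,
      counitFst_comul, one_mul, mul_one]
  have h₂ : (counitFst k H).comp (incRight k H) = AlgHom.id k H :=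
    AlgHom.ext counitFst_one_tmul
  have h₃ : (counitFst k H).toLinearMap ∘ₗ nu R = convUnit k H H := by
    rw [nu_eq_conv, algHom_comp_conv, algHom_comp_antipodeComp, h₁, h₂]
    exact antipodeComp_conv (AlgHom.id k H)
  exact LinearMap.congr_fun h₃ h

end IsSemiquasitriangular

end Structure

/-! ### The coproduct of the first leg of `ν`. -/

section TensorNu

variable {k : Type u} {H : Type v} [Field k] [Ring H] [HopfAlgebra k H]

lemma conv_mulLeft_comp_of_commute {A : Type*} [Ring A] [Algebra k A] {a : A} {φ : H →ₗ[k] A}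
    (h : ∀ x, Commute a (φ x)) (ψ : H →ₗ[k] A) :
    conv φ (LinearMap.mulLeft k a ∘ₗ ψ) = LinearMap.mulLeft k a ∘ₗ conv φ ψ := by
  rw [← conv_mulRight_comp, mulLeft_comp_conv]
  congr 1
  ext x
  exact (h x).symm

/-- Elements of `1 ⊗ H ⊗ Z(H)` commute with elements of `H ⊗ 1 ⊗ H`. -/
lemma commute_inc13_inc23 {w : H ⊗[k] H} (hw : w ∈ tensorCenter k H H) (X : H ⊗[k] H) :
    Commute (inc13 k H X) (inc23 k H w) := by
  refine tensorCenter_induction (p := fun w => Commute (inc13 k H X) (inc23 k H w)) ?_ ?_ ?_ hw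
  · simp
  · intro u w hu hw
    rw [map_add]
    exact hu.add_right hw
  · intro m z hz
    induction X with
    | zero => simp
    | add x y hx hy => rw [map_add]; exact hx.add_left hy
    | tmul a b =>
      simp only [Commute, SemiconjBy, inc13_tmul, inc23_tmul,
        Algebra.TensorProduct.tmul_mul_tmul, one_mul, mul_one, Subalgebra.mem_center_iff.1 hz b]

lemma commute_inc1_inc23 (h : H) (X : H ⊗[k] H) :
    Commute (inc23 k H X) (inc12 k H (incLeft k H h)) := by
  induction X with
  | zero => simp
  | add x y hx hy => rw [map_add]; exact hx.add_left hy
  | tmul a b => simp [Commute, SemiconjBy, inc23_tmul, inc12_apply, incLeft]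

variable (k H) in
/-- `a ⊗ b ↦ a₁ ⊗ a₂ ⊗ b`. -/
def comulFst : H ⊗[k] H →ₐ[k] (H ⊗[k] H) ⊗[k] H :=
  Algebra.TensorProduct.map (Bialgebra.comulAlgHom k H) (AlgHom.id k H)

lemma comulFst_apply (X : H ⊗[k] H) :
    comulFst k H X = (Coalgebra.comul (R := k) (A := H)).rTensor H X := rfl

lemma algHom_comp_conjComul {B : Type*} [Ring B] [Algebra k B] (p : H ⊗[k] H →ₐ[k] B)
    (R : H ⊗[k] H) : p.toLinearMap ∘ₗ conjComul R = LinearMap.mulLeft k (p (flipAntipode R)) ∘ₗ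
      LinearMap.mulRight k (p (swap R)) ∘ₗ p.toLinearMap ∘ₗ Coalgebra.comul := by
  ext h
  change p (conjComul R h) = _ * (p (Coalgebra.comul h) * _)
  rw [conjComul_apply, map_mul, map_mul]

namespace IsSemiquasitriangular

variable {R : H ⊗[k] H} (hR : IsSemiquasitriangular R)

include hR

/-- `comulFst` is an algebra homomorphism, so the formula for `(Δ ⊗ id)(R₂₁)` may be inverted,
reversing the factors. -/
lemma comulFst_flipAntipode : comulFst k H (flipAntipode R) =
    inc13 k H (flipAntipode R) * inc23 k H (flipAntipode R) := by
  have h : comulFst k H (swap R) *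
      (inc13 k H (flipAntipode R) * inc23 k H (flipAntipode R)) = 1 := by
    rw [comulFst_apply, hR.rTensor_comul_swap, mul_assoc, ← mul_assoc (inc13 k H (swap R)),
      ← map_mul, hR.swap_mul_flipAntipode, map_one, one_mul, ← map_mul,
      hR.swap_mul_flipAntipode, map_one]
  rw [← one_mul (inc13 k H _ * _), ← map_one (comulFst k H), ← hR.flipAntipode_mul_swap,
    map_mul, mul_assoc, h, mul_one]

/-- `(Δ ⊗ id)(ν(h)) = ν(h₁)₁₃ ν(h₂)₂₃`. -/
lemma conv_inc13_nu_inc23_nu :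
    conv ((inc13 k H).toLinearMap ∘ₗ nu R) ((inc23 k H).toLinearMap ∘ₗ nu R) =
      (comulFst k H).toLinearMap ∘ₗ nu R := by
  let i₁ := (inc12 k H).comp (incLeft k H)
  let i₂ := (inc12 k H).comp (incRight k H)
  let i₃ : H →ₐ[k] (H ⊗[k] H) ⊗[k] H := Algebra.TensorProduct.includeRight
  have h13 : (inc13 k H).comp (incRight k H) = i₃ := rfl
  have h23 : (inc23 k H).comp (incRight k H) = i₃ := rfl
  have hD : (comulFst k H).comp (incRight k H) = i₃ :=
    AlgHom.ext fun x => congrArg (· ⊗ₜ[k] x) (Bialgebra.comul_one (R := k) (A := H))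
  have hD' : (comulFst k H).toLinearMap ∘ₗ (incLeft k H).toLinearMap =
    (inc12 k H).toLinearMap ∘ₗ Coalgebra.comul := rfl
  -- Convolving with the last-leg inclusion `i₃` on the left turns each copy of `ν` into the
  -- corresponding copy of `R₂₁⁻¹ Δ R₂₁`.
  have step : ∀ p : H ⊗[k] H →ₐ[k] (H ⊗[k] H) ⊗[k] H, p.comp (incRight k H) = i₃ →
      conv i₃.toLinearMap (p.toLinearMap ∘ₗ nu R) = p.toLinearMap ∘ₗ conjComul R := by
    intro p hp
    rw [← hp, ← conv_incRight_nu R, algHom_comp_conv]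
    rfl
  -- `i₃` is convolution-invertible and may be cancelled.
  suffices h : conv i₃.toLinearMap (conv ((inc13 k H).toLinearMap ∘ₗ nu R)
      ((inc23 k H).toLinearMap ∘ₗ nu R)) =
      conv i₃.toLinearMap ((comulFst k H).toLinearMap ∘ₗ nu R) by
    simpa only [antipodeComp_conv_conv] using congrArg (conv (antipodeComp i₃)) h
  have hc13 : (inc13 k H).toLinearMap ∘ₗ Coalgebra.comul =
      conv i₁.toLinearMap i₃.toLinearMap := by
    rw [← conv_incLeft_incRight, algHom_comp_conv]
    rfl
  have hc23 : (inc23 k H).toLinearMap ∘ₗ Coalgebra.comul =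
      conv i₂.toLinearMap i₃.toLinearMap := by
    rw [← conv_incLeft_incRight, algHom_comp_conv]
    rfl
  have hc12 : (inc12 k H).toLinearMap ∘ₗ Coalgebra.comul =
      conv i₁.toLinearMap i₂.toLinearMap := by
    rw [← conv_incLeft_incRight, algHom_comp_conv]
    rfl
  -- This is `(Δ ⊗ id)Δ(h) = h₁ ⊗ Δ(h₂)`.
  have hcD : (comulFst k H).toLinearMap ∘ₗ Coalgebra.comul =
      conv i₁.toLinearMap ((inc23 k H).toLinearMap ∘ₗ Coalgebra.comul) := by
    rw [hc23, ← conv_assoc, ← hc12, ← hD', ← hD]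
    nth_rw 1 [← conv_incLeft_incRight]
    rw [algHom_comp_conv]
    rfl
  -- As `ν` takes values in `H ⊗ Z(H)`, the factor `(R₂₁)₁₃` passes to the right of `ν(h₂)₂₃`.
  have hcentral : LinearMap.mulLeft k (inc13 k H (swap R)) ∘ₗ (inc23 k H).toLinearMap ∘ₗ nu R =
      LinearMap.mulRight k (inc13 k H (swap R)) ∘ₗ (inc23 k H).toLinearMap ∘ₗ nu R :=
    LinearMap.ext fun x => commute_inc13_inc23 (hR.nu_mem x) _
  have hcomm : ∀ x : H, Commute (inc23 k H (flipAntipode R)) (i₁.toLinearMap x) :=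
    fun x => commute_inc1_inc23 x _
  -- After `(R₂₁)₁₃` has moved right, `i₃` is split off from `Δ₁₃` and absorbs `ν₂₃`, and
  -- `(R₂₁)₂₃⁻¹` passes to the left of `i₁`. Both sides become `(R₂₁)₁₃⁻¹ (R₂₁)₂₃⁻¹ (h₁ ⊗ h₂ ⊗ h₃)
  -- (R₂₁)₂₃ (R₂₁)₁₃`.
  rw [← conv_assoc, step _ h13, step _ hD, algHom_comp_conjComul, algHom_comp_conjComul,
    hR.comulFst_flipAntipode, comulFst_apply, hR.rTensor_comul_swap, ← mulLeft_comp_conv,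
    conv_mulRight_comp, hcentral, ← mulRight_comp_conv, hc13, conv_assoc, step _ h23,
    algHom_comp_conjComul, conv_mulLeft_comp_of_commute hcomm, ← mulRight_comp_conv, ← hcD]
  ext x
  simp [mul_assoc]

end IsSemiquasitriangular

end TensorNu

end SemiQT

namespace SemiQT

/-! ### Actions on tensor products, and closure of normality under unit and tensor product. -/

section Actions

variable {k : Type u} {H : Type v} [Field k] [Ring H] [HopfAlgebra k H]

/-- The action of `A ⊗ B` on `M ⊗ N`. -/
def pairAct {A B M N : Type*} [Ring A] [Algebra k A] [Ring B] [Algebra k B]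
    [AddCommGroup M] [Module k M] [AddCommGroup N] [Module k N]
    (a : A →ₐ[k] Module.End k M) (b : B →ₐ[k] Module.End k N) :
    A ⊗[k] B →ₐ[k] Module.End k (M ⊗[k] N) :=
  (Module.endTensorEndAlgHom (R := k) (S := k) (A := k)).comp (Algebra.TensorProduct.map a b)

lemma pairAct_tmul {A B M N : Type*} [Ring A] [Algebra k A] [Ring B] [Algebra k B]
    [AddCommGroup M] [Module k M] [AddCommGroup N] [Module k N]
    (a : A →ₐ[k] Module.End k M) (b : B →ₐ[k] Module.End k N) (x : A) (y : B) :
    pairAct a b (x ⊗ₜ[k] y) = TensorProduct.map (a x) (b y) := rfl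

variable {M N P : Type u} [AddCommGroup M] [Module k M] [AddCommGroup N] [Module k N]
  [AddCommGroup P] [Module k P]
  (a : H →ₐ[k] Module.End k M) (b : H →ₐ[k] Module.End k N) (e : H →ₐ[k] Module.End k P)

open ModComod

/-- The action of `H ⊗ H` on `M ⊗ H`, by left multiplication on the second factor. -/
def coactAct : H ⊗[k] H →ₐ[k] Module.End k (M ⊗[k] H) := pairAct a (Algebra.lmul k H)

lemma coactAct_tmul (x y z : H) (m : M) :
    coactAct a (x ⊗ₜ[k] y) (m ⊗ₜ[k] z) = a x m ⊗ₜ[k] (y * z) := rfl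

/-- The action of `H ⊗ H ⊗ H` on `M ⊗ N ⊗ H`, by left multiplication on the last factor. -/
def coactAct₃ : (H ⊗[k] H) ⊗[k] H →ₐ[k] Module.End k ((M ⊗[k] N) ⊗[k] H) :=
  pairAct (tensorAct a b) (Algebra.lmul k H)

lemma coactAct₃_tmul (x : H ⊗[k] H) (y z : H) (t : M ⊗[k] N) :
    coactAct₃ a b (x ⊗ₜ[k] y) (t ⊗ₜ[k] z) = tensorAct a b x t ⊗ₜ[k] (y * z) := rfl

/-- The action of `H ⊗ H ⊗ H` on `M ⊗ N ⊗ P`. -/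
def tensorAct₃ : (H ⊗[k] H) ⊗[k] H →ₐ[k] Module.End k ((M ⊗[k] N) ⊗[k] P) :=
  pairAct (tensorAct a b) e

lemma tensorAct₃_tmul (x : H ⊗[k] H) (y : H) (t : M ⊗[k] N) (p : P) :
    tensorAct₃ a b e (x ⊗ₜ[k] y) (t ⊗ₜ[k] p) = tensorAct a b x t ⊗ₜ[k] e y p := rfl

lemma tensorAct_tmul_tmul (x y : H) (m : M) (n : N) :
    tensorAct a b (x ⊗ₜ[k] y) (m ⊗ₜ[k] n) = a x m ⊗ₜ[k] b y n := rfl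

/-- The `H`-leg of `u` is central, so the last leg of `Y` can be moved to its left. -/
lemma mulLegs_coactAct {u : M ⊗[k] H} (hu : u ∈ tensorCenter k H M) (w : N ⊗[k] H)
    (X Y : H ⊗[k] H) :
    mulLegs (coactAct a X u ⊗ₜ[k] coactAct b Y w) =
      coactAct₃ a b (inc13 k H X * inc23 k H Y) (mulLegs (u ⊗ₜ[k] w)) := by
  refine tensorCenter_induction (p := fun u => mulLegs (coactAct a X u ⊗ₜ[k] coactAct b Y w) =
      coactAct₃ a b (inc13 k H X * inc23 k H Y) (mulLegs (u ⊗ₜ[k] w))) ?_ ?_ ?_ hu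
  · simp
  · intro u v hu hv
    simp only [map_add, add_tmul, hu, hv]
  · intro m z hz
    induction w with
    | zero => simp
    | add x y hx hy => simp only [map_add, tmul_add, hx, hy]
    | tmul n q =>
      induction X with
      | zero => simp
      | add x y hx hy => simp only [map_add, add_mul, LinearMap.add_apply, add_tmul, hx, hy]
      | tmul x x' =>
        induction Y with
        | zero => simp
        | add x y hx hy =>
          simp only [map_add, mul_add, LinearMap.add_apply, tmul_add, hx, hy]
        | tmul y y' =>
          rw [inc13_tmul, inc23_tmul, Algebra.TensorProduct.tmul_mul_tmul,
            Algebra.TensorProduct.tmul_mul_tmul, one_mul, mul_one, coactAct_tmul, coactAct_tmul,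
            mulLegs_tmul, mulLegs_tmul, coactAct₃_tmul, tensorAct_tmul_tmul]
          congr 1
          rw [mul_assoc, mul_assoc, ← mul_assoc z, ← mul_assoc y',
            Subalgebra.mem_center_iff.1 hz y']

lemma coactAct_diagAct (X : H ⊗[k] H) :
    coactAct (diagAct a b) X = coactAct₃ a b (comulFst k H X) := by
  induction X with
  | zero => simp
  | add x y hx hy => simp only [map_add, hx, hy]
  | tmul x y => rfl

lemma coactAct₃_inc12 (X : H ⊗[k] H) :
    coactAct₃ a b (inc12 k H X) = (tensorAct a b X).rTensor H := by
  rw [inc12_apply, coactAct₃, pairAct_tmul, map_one]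
  rfl

lemma tensorAct_diagAct_left (X : H ⊗[k] H) :
    tensorAct (diagAct a b) e X = tensorAct₃ a b e (comulFst k H X) := by
  induction X with
  | zero => simp
  | add x y hx hy => simp only [map_add, hx, hy]
  | tmul x y => rfl

lemma assoc_symm_tensorAct_diagAct (X : H ⊗[k] H) (z : M ⊗[k] (N ⊗[k] P)) :
    (TensorProduct.assoc k M N P).symm (tensorAct a (diagAct b e) X z) =
      tensorAct₃ a b e ((TensorProduct.assoc k H H H).symm
        ((Coalgebra.comul (R := k) (A := H)).lTensor H X))
        ((TensorProduct.assoc k M N P).symm z) := by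
  induction X with
  | zero => simp
  | add x y hx hy => simp only [map_add, LinearMap.add_apply, hx, hy]
  | tmul x y =>
    have key : ∀ t : H ⊗[k] H,
        (TensorProduct.assoc k M N P).symm (TensorProduct.map (a x) (tensorAct b e t) z) =
        tensorAct₃ a b e ((TensorProduct.assoc k H H H).symm (x ⊗ₜ[k] t))
          ((TensorProduct.assoc k M N P).symm z) := by
      intro t
      induction t with
      | zero => simp
      | add p q hp hq =>
        simp only [map_add, map_add_right, tmul_add, LinearMap.add_apply, hp, hq]
      | tmul p q =>
        induction z with
        | zero => simp
        | add z w hz hw => simp only [map_add, hz, hw]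
        | tmul m w =>
          induction w with
          | zero => simp
          | add z w hz hw => simp only [map_add, tmul_add, hz, hw]
          | tmul n p => rfl
    exact key _

lemma tensorAct₃_inc12_tmul (X : H ⊗[k] H) (t : M ⊗[k] N) (p : P) :
    tensorAct₃ a b e (inc12 k H X) (t ⊗ₜ[k] p) = tensorAct a b X t ⊗ₜ[k] p := by
  rw [inc12_apply, tensorAct₃_tmul, map_one]
  rfl

lemma tensorAct₃_inc23_assoc_symm (X : H ⊗[k] H) (m : M) (q : N ⊗[k] P) :
    tensorAct₃ a b e (inc23 k H X) ((TensorProduct.assoc k M N P).symm (m ⊗ₜ[k] q)) =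
      (TensorProduct.assoc k M N P).symm (m ⊗ₜ[k] tensorAct b e X q) := by
  induction X with
  | zero => simp
  | add x y hx hy => simp only [map_add, LinearMap.add_apply, tmul_add, hx, hy]
  | tmul x y =>
    induction q with
    | zero => simp
    | add z w hz hw => simp only [map_add, tmul_add, hz, hw]
    | tmul n p =>
      rw [inc23_tmul, TensorProduct.assoc_symm_tmul, tensorAct₃_tmul, tensorAct_tmul_tmul, map_one]
      rfl

lemma tensorAct₃_inc13_assoc_symm (x y : H) (m : M) (q : N ⊗[k] P) :
    tensorAct₃ a b e (inc13 k H (x ⊗ₜ[k] y)) ((TensorProduct.assoc k M N P).symm (m ⊗ₜ[k] q)) =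
      (TensorProduct.assoc k M N P).symm (a x m ⊗ₜ[k] tensorAct b e (1 ⊗ₜ[k] y) q) := by
  induction q with
  | zero => simp
  | add z w hz hw => simp only [map_add, tmul_add, hz, hw]
  | tmul n p =>
    rw [inc13_tmul, TensorProduct.assoc_symm_tmul, tensorAct₃_tmul, tensorAct_tmul_tmul,
      tensorAct_tmul_tmul, map_one]
    rfl

lemma mulLegs_mem_tensorCenter {u : M ⊗[k] H} {w : N ⊗[k] H} (hu : u ∈ tensorCenter k H M)
    (hw : w ∈ tensorCenter k H N) :
    (mulLegs (u ⊗ₜ[k] w) : (M ⊗[k] N) ⊗[k] H) ∈ tensorCenter k H (M ⊗[k] N) := by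
  refine tensorCenter_induction
    (p := fun u => mulLegs (u ⊗ₜ[k] w) ∈ tensorCenter k H (M ⊗[k] N)) ?_ ?_ ?_ hu
  · simp
  · intro u v hu hv
    rw [add_tmul, map_add]
    exact add_mem hu hv
  · intro m z hz
    refine tensorCenter_induction
      (p := fun w => mulLegs ((m ⊗ₜ[k] z) ⊗ₜ[k] w) ∈ tensorCenter k H (M ⊗[k] N)) ?_ ?_ ?_ hw
    · simp
    · intro u v hu hv
      rw [tmul_add, map_add]
      exact add_mem hu hv
    · intro n y hy
      rw [mulLegs_tmul]
      exact tmul_mem_tensorCenter _ (mul_mem hz hy)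

/-- The coaction `c` is compatible with the action `a` through `ν`. -/
def IsNuCompatible (R : H ⊗[k] H) (a : H →ₐ[k] Module.End k M) (c : M →ₗ[k] M ⊗[k] H) : Prop :=
  ∀ (h : H) (m : M), c (a h m) = coactAct a (nu R h) (c m)

section Coaction

variable {a b} {R : H ⊗[k] H} {c : M →ₗ[k] M ⊗[k] H} {d : N →ₗ[k] N ⊗[k] H}

/-- Stated for an arbitrary `t` because it serves twice: `t = Δ(h)` gives the normality of tensor
products, and `t = R₂₁` enters the colinearity of the braiding. -/
lemma diagCoact_tensorAct (hc : ∀ m, c m ∈ tensorCenter k H M) (hac : IsNuCompatible R a c)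
    (hbd : IsNuCompatible R b d) (t : H ⊗[k] H) (z : M ⊗[k] N) :
    diagCoact c d (tensorAct a b t z) =
      coactAct₃ a b (LinearMap.mul' k _ (TensorProduct.map ((inc13 k H).toLinearMap ∘ₗ nu R)
        ((inc23 k H).toLinearMap ∘ₗ nu R) t)) (diagCoact c d z) := by
  induction z with
  | zero => simp
  | add x y hx hy => simp only [map_add, hx, hy]
  | tmul m n =>
    induction t with
    | zero => simp
    | add x y hx hy => simp only [map_add, LinearMap.add_apply, hx, hy]
    | tmul x y =>
      rw [tensorAct_tmul_tmul, diagCoact_tmul, diagCoact_tmul, hac, hbd,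
        mulLegs_coactAct a b (hc m)]
      rfl

lemma diagCoact_mem_tensorCenter (hc : ∀ m, c m ∈ tensorCenter k H M)
    (hd : ∀ n, d n ∈ tensorCenter k H N) (z : M ⊗[k] N) :
    diagCoact c d z ∈ tensorCenter k H (M ⊗[k] N) := by
  induction z with
  | zero => simp
  | add x y hx hy => rw [map_add]; exact add_mem hx hy
  | tmul m n => exact mulLegs_mem_tensorCenter (hc m) (hd n)

lemma IsSemiquasitriangular.isNuCompatible_diag (hR : IsSemiquasitriangular R)
    (hc : ∀ m, c m ∈ tensorCenter k H M) (hac : IsNuCompatible R a c)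
    (hbd : IsNuCompatible R b d) : IsNuCompatible R (diagAct a b) (diagCoact c d) := by
  intro h z
  rw [coactAct_diagAct]
  exact (diagCoact_tensorAct hc hac hbd _ z).trans (congrArg (fun X => coactAct₃ a b X _)
    (LinearMap.congr_fun hR.conv_inc13_nu_inc23_nu h))

end Coaction

lemma coactAct_trivAct_tmul (X : H ⊗[k] H) (x : k) (y : H) :
    coactAct (trivAct k H) X (x ⊗ₜ[k] y) = x ⊗ₜ[k] (counitFst k H X * y) := by
  induction X with
  | zero => simp
  | add p q hp hq => simp only [map_add, LinearMap.add_apply, add_mul, tmul_add, hp, hq]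
  | tmul p q =>
    rw [coactAct_tmul, trivAct_apply, counitFst_tmul, smul_mul_assoc, tmul_smul, smul_tmul',
      smul_eq_mul]

lemma IsSemiquasitriangular.isNormal_unit {R : H ⊗[k] H} (hR : IsSemiquasitriangular R) :
    IsNormal R (ModComod.unit k H) := by
  refine ⟨fun x => tmul_mem_tensorCenter (M := k) x (one_mem _), fun h (x : k) => ?_⟩
  change (trivAct k H h x) ⊗ₜ[k] (1 : H) = coactAct (trivAct k H) (nu R h) (x ⊗ₜ[k] (1 : H))
  rw [coactAct_trivAct_tmul, hR.counitFst_nu, mul_one, trivAct_apply,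
    Algebra.algebraMap_eq_smul_one, tmul_smul, smul_tmul', smul_eq_mul]

lemma IsSemiquasitriangular.isNormal_tensor {R : H ⊗[k] H} (hR : IsSemiquasitriangular R)
    {M N : ModComod k H} (hM : IsNormal R M) (hN : IsNormal R N) : IsNormal R (tensor M N) :=
  ⟨diagCoact_mem_tensorCenter hM.1 hN.1, hR.isNuCompatible_diag hM.1 hM.2 hN.2⟩

end Actions

/-! ### The braiding: linearity, invertibility, colinearity, naturality and hexagons. -/

section Twist

variable {k : Type u} {H : Type v} [Field k] [Ring H] [HopfAlgebra k H]
  {M N P : Type u} [AddCommGroup M] [Module k M] [AddCommGroup N] [Module k N]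
  [AddCommGroup P] [Module k P]

open ModComod

/-- The map `n ⊗ h ↦ n ⊗ φ(h)(m)`. -/
def evalAt (N : Type u) [AddCommGroup N] [Module k N] (φ : H →ₗ[k] Module.End k M) (m : M) :
    N ⊗[k] H →ₗ[k] N ⊗[k] M :=
  (φ.flip m).lTensor N

lemma evalAt_tmul (φ : H →ₗ[k] Module.End k M) (m : M) (n : N) (h : H) :
    evalAt N φ m (n ⊗ₜ[k] h) = n ⊗ₜ[k] φ h m := rfl

/-- The map `n ⊗ m ↦ n₀ ⊗ φ(n₁)(m)`. -/
def twist (d : N →ₗ[k] N ⊗[k] H) (φ : H →ₗ[k] Module.End k M) : N ⊗[k] M →ₗ[k] N ⊗[k] M :=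
  (TensorProduct.lift φ).lTensor N ∘ₗ (TensorProduct.assoc k N H M).toLinearMap ∘ₗ d.rTensor M

lemma twist_tmul (d : N →ₗ[k] N ⊗[k] H) (φ : H →ₗ[k] Module.End k M) (n : N) (m : M) :
    twist d φ (n ⊗ₜ[k] m) = evalAt N φ m (d n) := by
  change (TensorProduct.lift φ).lTensor N (TensorProduct.assoc k N H M (d n ⊗ₜ[k] m)) = _
  induction d n with
  | zero => simp
  | add x y hx hy => simp only [map_add, add_tmul, hx, hy]
  | tmul x y => rfl

/-- Coassociativity turns the two successive coactions into `Δ(n₁)`. Hence a convolution inverse of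
`φ` yields an inverse of `twist d φ`. -/
lemma twist_comp_twist {d : N →ₗ[k] N ⊗[k] H}
    (hd : ∀ n, TensorProduct.assoc k N H H (d.rTensor H (d n)) =
      (Coalgebra.comul (R := k) (A := H)).lTensor N (d n))
    (φ ψ : H →ₗ[k] Module.End k M) : twist d φ ∘ₗ twist d ψ = twist d (conv φ ψ) := by
  refine TensorProduct.ext' fun n m => ?_
  have h₁ : ∀ w : N ⊗[k] H, twist d φ (evalAt N ψ m w) =
      ((LinearMap.mul' k _ ∘ₗ TensorProduct.map φ ψ).flip m).lTensor N
        (TensorProduct.assoc k N H H (d.rTensor H w)) := by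
    intro w
    induction w with
    | zero => simp
    | add x y hx hy => simp only [map_add, hx, hy]
    | tmul n x =>
      rw [evalAt_tmul, twist_tmul, LinearMap.rTensor_tmul]
      induction d n with
      | zero => simp
      | add x y hx hy => simp only [map_add, add_tmul, hx, hy]
      | tmul x y => rfl
  rw [LinearMap.comp_apply, twist_tmul, twist_tmul, h₁, hd, ← LinearMap.comp_apply,
    ← LinearMap.lTensor_comp]
  rfl

lemma twist_convUnit {d : N →ₗ[k] N ⊗[k] H}
    (hd : ∀ n, TensorProduct.rid k N
      ((Coalgebra.counit (R := k) (A := H)).lTensor N (d n)) = n) :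
    twist d (convUnit k H (Module.End k M)) = LinearMap.id := by
  refine TensorProduct.ext' fun n m => ?_
  have h₁ : ∀ w : N ⊗[k] H, evalAt N (convUnit k H (Module.End k M)) m w =
      TensorProduct.rid k N ((Coalgebra.counit (R := k) (A := H)).lTensor N w) ⊗ₜ[k] m := by
    intro w
    induction w with
    | zero => simp
    | add x y hx hy => simp only [map_add, add_tmul, hx, hy]
    | tmul n x =>
      rw [evalAt_tmul, LinearMap.lTensor_tmul, TensorProduct.rid_tmul, smul_tmul]
      rfl
  rw [twist_tmul, h₁, hd]
  rfl

/-- The map `m ⊗ n ↦ n₀ ⊗ n₁ · m`. -/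
def insertAct (a : H →ₐ[k] Module.End k M) (d : N →ₗ[k] N ⊗[k] H) : M ⊗[k] N →ₗ[k] N ⊗[k] M :=
  twist d a.toLinearMap ∘ₗ (TensorProduct.comm k M N).toLinearMap

lemma insertAct_tmul (a : H →ₐ[k] Module.End k M) (d : N →ₗ[k] N ⊗[k] H) (m : M) (n : N) :
    insertAct a d (m ⊗ₜ[k] n) = evalAt N a.toLinearMap m (d n) := twist_tmul _ _ _ _

/-- The map `m ⊗ n ↦ R⁽²⁾ · n₀ ⊗ R⁽¹⁾ n₁ · m`. -/
def braidLin (R : H ⊗[k] H) (a : H →ₐ[k] Module.End k M) (b : H →ₐ[k] Module.End k N)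
    (d : N →ₗ[k] N ⊗[k] H) : M ⊗[k] N →ₗ[k] N ⊗[k] M :=
  tensorAct b a (swap R) ∘ₗ insertAct a d

lemma braidMap_eq_braidLin (R : H ⊗[k] H) (M N : ModComod k H) :
    braidMap R M N = braidLin R M.act N.act N.coact :=
  TensorProduct.ext' fun _ _ => rfl

lemma braidLin_tmul (R : H ⊗[k] H) (a : H →ₐ[k] Module.End k M) (b : H →ₐ[k] Module.End k N)
    (d : N →ₗ[k] N ⊗[k] H) (m : M) (n : N) : braidLin R a b d (m ⊗ₜ[k] n) =
      tensorAct b a (swap R) (evalAt N a.toLinearMap m (d n)) :=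
  congrArg (tensorAct b a (swap R)) (insertAct_tmul a d m n)

section Lemmas

variable (a : H →ₐ[k] Module.End k M) (b : H →ₐ[k] Module.End k N)

lemma evalAt_coactAct (m : M) (X : H ⊗[k] H) (w : N ⊗[k] H) :
    evalAt N a.toLinearMap m (coactAct b X w) =
      tensorAct b a X (evalAt N a.toLinearMap m w) := by
  induction X with
  | zero => simp
  | add x y hx hy => simp only [map_add, LinearMap.add_apply, hx, hy]
  | tmul x y =>
    induction w with
    | zero => simp
    | add p q hp hq => simp only [map_add, hp, hq]
    | tmul n z =>
      rw [coactAct_tmul, evalAt_tmul, evalAt_tmul, tensorAct_tmul_tmul, AlgHom.toLinearMap_apply,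
        map_mul]
      rfl

/-- The `H`-leg of `w` is central, hence commutes with `x` before acting on `m`. -/
lemma evalAt_act (m : M) (x : H) {w : N ⊗[k] H} (hw : w ∈ tensorCenter k H N) :
    evalAt N a.toLinearMap (a x m) w =
      tensorAct b a (1 ⊗ₜ[k] x) (evalAt N a.toLinearMap m w) := by
  refine tensorCenter_induction (p := fun w => evalAt N a.toLinearMap (a x m) w =
      tensorAct b a (1 ⊗ₜ[k] x) (evalAt N a.toLinearMap m w)) ?_ ?_ ?_ hw
  · simp
  · intro u v hu hv
    simp only [map_add, hu, hv]
  · intro n z hz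
    rw [evalAt_tmul, evalAt_tmul, tensorAct_tmul_tmul, map_one, AlgHom.toLinearMap_apply,
      ← Module.End.mul_apply, ← Module.End.mul_apply, ← map_mul, ← map_mul,
      Subalgebra.mem_center_iff.1 hz x]
    rfl

end Lemmas

variable {R : H ⊗[k] H} {a : H →ₐ[k] Module.End k M} {b : H →ₐ[k] Module.End k N}
  {e : H →ₐ[k] Module.End k P} {c : M →ₗ[k] M ⊗[k] H} {d : N →ₗ[k] N ⊗[k] H}
  {f : P →ₗ[k] P ⊗[k] H}

/-- For `t = x ⊗ y`, centrality pulls `x` out of the insertion and the coaction of `y · n`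
contributes `ν(y)`. With `t = Δ(h)` the product is `R₂₁⁻¹ Δ(h) R₂₁`. -/
lemma insertAct_tensorAct (hd : ∀ n, d n ∈ tensorCenter k H N) (hbd : IsNuCompatible R b d)
    (t : H ⊗[k] H) (z : M ⊗[k] N) : insertAct a d (tensorAct a b t z) =
      tensorAct b a (LinearMap.mul' k _ (TensorProduct.map (incRight k H).toLinearMap (nu R) t))
        (insertAct a d z) := by
  induction z with
  | zero => simp
  | add x y hx hy => simp only [map_add, hx, hy]
  | tmul m n =>
    induction t with
    | zero => simp
    | add x y hx hy => simp only [map_add, LinearMap.add_apply, hx, hy]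
    | tmul x y =>
      rw [tensorAct_tmul_tmul, insertAct_tmul, insertAct_tmul, evalAt_act a b _ _ (hd _), hbd,
        evalAt_coactAct, TensorProduct.map_tmul, LinearMap.mul'_apply, map_mul]
      rfl

/-- The braiding is `H`-linear. -/
lemma IsSemiquasitriangular.braidLin_diagAct (hR : IsSemiquasitriangular R)
    (hd : ∀ n, d n ∈ tensorCenter k H N) (hbd : IsNuCompatible R b d) (h : H) :
    braidLin R a b d ∘ₗ diagAct a b h = diagAct b a h ∘ₗ braidLin R a b d := by
  refine LinearMap.ext fun z => ?_
  change tensorAct b a (swap R) (insertAct a d (tensorAct a b (Coalgebra.comul h) z)) =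
    tensorAct b a (Coalgebra.comul h) (tensorAct b a (swap R) (insertAct a d z))
  rw [insertAct_tensorAct hd hbd]
  change tensorAct b a (swap R) (tensorAct b a (conv (incRight k H).toLinearMap (nu R) h) _) = _
  rw [conv_incRight_nu, conjComul_apply, ← Module.End.mul_apply, ← Module.End.mul_apply,
    ← map_mul, ← map_mul, ← mul_assoc, hR.swap_mul_flipAntipode, one_mul]

/-- The inverse of the braiding. -/
def braidInv (R : H ⊗[k] H) (a : H →ₐ[k] Module.End k M) (b : H →ₐ[k] Module.End k N)
    (d : N →ₗ[k] N ⊗[k] H) : N ⊗[k] M →ₗ[k] M ⊗[k] N :=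
  (TensorProduct.comm k N M).toLinearMap ∘ₗ twist d (antipodeComp a) ∘ₗ
    tensorAct b a (flipAntipode R)

/-- The braiding as a linear equivalence. -/
def IsSemiquasitriangular.braidEquiv (hR : IsSemiquasitriangular R) (M N : ModComod k H) :
    M ⊗[k] N ≃ₗ[k] N ⊗[k] M :=
  have hassoc : ∀ n, TensorProduct.assoc k N H H (N.coact.rTensor H (N.coact n)) =
      (Coalgebra.comul (R := k) (A := H)).lTensor N (N.coact n) := LinearMap.congr_fun N.coassoc
  have hcounit : ∀ n, TensorProduct.rid k N
      ((Coalgebra.counit (R := k) (A := H)).lTensor N (N.coact n)) = n :=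
    LinearMap.congr_fun N.counit
  LinearEquiv.ofLinearMap (braidMap R M N) (braidInv R M.act N.act N.coact)
    (by
      refine LinearMap.ext fun z => ?_
      have h₁ := LinearMap.congr_fun
        (twist_comp_twist hassoc M.act.toLinearMap (antipodeComp M.act))
        (tensorAct N.act M.act (flipAntipode R) z)
      rw [conv_antipodeComp, twist_convUnit hcounit] at h₁
      rw [braidMap_eq_braidLin]
      change tensorAct N.act M.act (swap R) (twist _ _ (TensorProduct.comm k M N
        ((TensorProduct.comm k M N).symm
          (twist _ _ (tensorAct N.act M.act (flipAntipode R) z))))) = z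
      rw [LinearEquiv.apply_symm_apply]
      refine (congrArg (tensorAct N.act M.act (swap R)) h₁).trans ?_
      rw [LinearMap.id_apply, ← Module.End.mul_apply, ← map_mul, hR.swap_mul_flipAntipode, map_one,
        Module.End.one_apply])
    (by
      refine LinearMap.ext fun z => ?_
      have h₁ := LinearMap.congr_fun
        (twist_comp_twist hassoc (antipodeComp M.act) M.act.toLinearMap)
        (TensorProduct.comm k M N z)
      rw [antipodeComp_conv, twist_convUnit hcounit] at h₁
      rw [braidMap_eq_braidLin]
      change (TensorProduct.comm k M N).symm (twist _ _ (tensorAct N.act M.act (flipAntipode R)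
        (tensorAct N.act M.act (swap R) (twist _ _ (TensorProduct.comm k M N z))))) = z
      rw [← Module.End.mul_apply (tensorAct N.act M.act (flipAntipode R)), ← map_mul,
        hR.flipAntipode_mul_swap, map_one, Module.End.one_apply]
      refine (congrArg (TensorProduct.comm k M N).symm h₁).trans ?_
      rw [LinearMap.id_apply, LinearEquiv.symm_apply_apply])

/-- `ν(R⁽²⁾)₁₃ ν(R⁽¹⁾)₂₃ = R⁽²⁾ ⊗ R⁽¹⁾ ⊗ 1`. -/
lemma IsSemiquasitriangular.mul_nu_swap (hR : IsSemiquasitriangular R) :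
    LinearMap.mul' k _ (TensorProduct.map ((inc13 k H).toLinearMap ∘ₗ nu R)
      ((inc23 k H).toLinearMap ∘ₗ nu R) (swap R)) = inc12 k H (swap R) := by
  let i₁ := (inc12 k H).comp (incLeft k H)
  let Ψ : (H ⊗[k] H) ⊗[k] H →ₗ[k] (H ⊗[k] H) ⊗[k] H := LinearMap.mul' k _ ∘ₗ
    TensorProduct.map (inc13 k H).toLinearMap ((inc23 k H).toLinearMap ∘ₗ nu R)
  let Ω : (H ⊗[k] H) ⊗[k] H →ₗ[k] (H ⊗[k] H) ⊗[k] H := LinearMap.mul' k _ ∘ₗ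
    TensorProduct.map i₁.toLinearMap (inc23 k H).toLinearMap ∘ₗ
      (TensorProduct.comm k (H ⊗[k] H) H).toLinearMap
  have h₁ : ∀ X : H ⊗[k] H, LinearMap.mul' k _ (TensorProduct.map
      ((inc13 k H).toLinearMap ∘ₗ nu R) ((inc23 k H).toLinearMap ∘ₗ nu R) X) =
      Ψ ((nu R).rTensor H X) := by
    intro X
    induction X with
    | zero => simp
    | add x y hx hy => simp only [map_add, hx, hy]
    | tmul x y => rfl
  -- Once the `ν` applied to `R⁽²⁾` has disappeared, flipping the tensor factors presents the other
  -- one as `ν` applied to the first leg of `R`.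
  have h₂ : ∀ X : H ⊗[k] H, Ψ (inc13 k H (swap X)) = Ω ((nu R).rTensor H X) := by
    intro X
    induction X with
    | zero => simp
    | add x y hx hy => simp only [map_add, hx, hy]
    | tmul x y => rfl
  have h₃ : ∀ X : H ⊗[k] H, Ω (inc13 k H X) = inc12 k H (swap X) := by
    intro X
    induction X with
    | zero => simp
    | add x y hx hy => simp only [map_add, hx, hy]
    | tmul x y =>
      change ((y ⊗ₜ[k] (1 : H)) ⊗ₜ[k] (1 : H)) * (((1 : H) ⊗ₜ[k] x) ⊗ₜ[k] (1 : H)) =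
        (y ⊗ₜ[k] x) ⊗ₜ[k] (1 : H)
      simp
  rw [h₁, hR.rTensor_nu_swap, h₂, hR.rTensor_nu, h₃]

/-- The action `a` is auxiliary: only `a 1 = id` enters, and it allows left multiplication by `x` to
be written as `coactAct`. -/
lemma mulLegs_tmul_left (n : N) (x : H) (v : M ⊗[k] H) :
    mulLegs ((n ⊗ₜ[k] x) ⊗ₜ[k] v) =
      (TensorProduct.assoc k N M H).symm (n ⊗ₜ[k] coactAct a (incRight k H x) v) := by
  induction v with
  | zero => simp
  | add p q hp hq => simp only [map_add, tmul_add, hp, hq]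
  | tmul m y =>
    change _ = (TensorProduct.assoc k N M H).symm (n ⊗ₜ[k] (a 1 m ⊗ₜ[k] (x * y)))
    rw [map_one]
    rfl

/-- The legs `n₁` and `n₂` of `n₀ ⊗ n₁ ⊗ n₂` are central. -/
lemma lTensor_conj_comul {d : N →ₗ[k] N ⊗[k] H} (hd : ∀ n, d n ∈ tensorCenter k H N)
    (g : H ⊗[k] H) (n : N) :
    (LinearMap.mulRight k g).lTensor N (TensorProduct.assoc k N H H (d.rTensor H (d n))) =
      (LinearMap.mulLeft k g).lTensor N (TensorProduct.assoc k N H H (d.rTensor H (d n))) := by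
  refine tensorCenter_induction (p := fun w =>
    (LinearMap.mulRight k g).lTensor N (TensorProduct.assoc k N H H (d.rTensor H w)) =
      (LinearMap.mulLeft k g).lTensor N (TensorProduct.assoc k N H H (d.rTensor H w)))
    ?_ ?_ ?_ (hd n)
  · simp
  · intro u v hu hv
    simp only [map_add, hu, hv]
  · intro n z hz
    rw [LinearMap.rTensor_tmul]
    refine tensorCenter_induction (p := fun w =>
      (LinearMap.mulRight k g).lTensor N (TensorProduct.assoc k N H H (w ⊗ₜ[k] z)) =
        (LinearMap.mulLeft k g).lTensor N (TensorProduct.assoc k N H H (w ⊗ₜ[k] z)))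
      ?_ ?_ ?_ (hd n)
    · simp
    · intro u v hu hv
      simp only [map_add, add_tmul, hu, hv]
    · intro m y hy
      refine congrArg (m ⊗ₜ[k] ·) ?_
      change (y ⊗ₜ[k] z) * g = g * (y ⊗ₜ[k] z)
      induction g with
      | zero => simp
      | add p q hp hq => rw [mul_add, add_mul, hp, hq]
      | tmul p q =>
        rw [Algebra.TensorProduct.tmul_mul_tmul, Algebra.TensorProduct.tmul_mul_tmul,
          Subalgebra.mem_center_iff.1 hy p, Subalgebra.mem_center_iff.1 hz q]

/-- By coassociativity `n₀ ⊗ Δ(n₁)` comes from coacting twice, so both legs of `Δ(n₁)` are central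
and `R₂₁` cancels against its inverse. -/
lemma IsSemiquasitriangular.lTensor_conjComul (hR : IsSemiquasitriangular R)
    (hd : ∀ n, d n ∈ tensorCenter k H N)
    (hassoc : ∀ n, TensorProduct.assoc k N H H (d.rTensor H (d n)) =
      (Coalgebra.comul (R := k) (A := H)).lTensor N (d n)) (n : N) :
    (conjComul R).lTensor N (d n) = (Coalgebra.comul (R := k) (A := H)).lTensor N (d n) := by
  rw [conjComul, LinearMap.lTensor_comp, LinearMap.lTensor_comp, LinearMap.comp_apply,
    LinearMap.comp_apply, ← hassoc, lTensor_conj_comul hd, ← LinearMap.comp_apply,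
    ← LinearMap.lTensor_comp, ← LinearMap.mulLeft_mul, hR.flipAntipode_mul_swap,
    LinearMap.mulLeft_one, LinearMap.lTensor_id, LinearMap.id_apply]

/-- At `w = d n` the right side is `n₀ ⊗ (1 ⊗ n₁) ν(n₂) · c(m)`, a form to which `conv_incRight_nu`
applies. -/
lemma diagCoact_evalAt (hac : IsNuCompatible R a c) (m : M) (w : N ⊗[k] H) :
    diagCoact d c (evalAt N a.toLinearMap m w) = (TensorProduct.assoc k N M H).symm
      (((coactAct a).toLinearMap.flip (c m) ∘ₗ LinearMap.mul' k _ ∘ₗ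
        TensorProduct.map (incRight k H).toLinearMap (nu R)).lTensor N
          (TensorProduct.assoc k N H H (d.rTensor H w))) := by
  induction w with
  | zero => simp
  | add p q hp hq => simp only [map_add, hp, hq]
  | tmul n x =>
    rw [evalAt_tmul, diagCoact_tmul, AlgHom.toLinearMap_apply, hac, LinearMap.rTensor_tmul]
    induction d n with
    | zero => simp
    | add p q hp hq => simp only [map_add, add_tmul, hp, hq]
    | tmul n y =>
      rw [mulLegs_tmul_left (a := a), ← Module.End.mul_apply, ← map_mul]
      rfl

lemma rTensor_insertAct_mulLegs {u : M ⊗[k] H} (hu : u ∈ tensorCenter k H M) (w : N ⊗[k] H) :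
    (insertAct a d).rTensor H (mulLegs (u ⊗ₜ[k] w)) = (TensorProduct.assoc k N M H).symm
      (((coactAct a).toLinearMap.flip u).lTensor N
        (TensorProduct.assoc k N H H (d.rTensor H w))) := by
  refine tensorCenter_induction (p := fun u => (insertAct a d).rTensor H (mulLegs (u ⊗ₜ[k] w)) =
    (TensorProduct.assoc k N M H).symm (((coactAct a).toLinearMap.flip u).lTensor N
        (TensorProduct.assoc k N H H (d.rTensor H w)))) ?_ ?_ ?_ hu
  · simp
  · intro u v hu hv
    simp only [map_add, add_tmul, LinearMap.lTensor_add, LinearMap.add_apply, hu, hv]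
  · intro m z hz
    induction w with
    | zero => simp
    | add p q hp hq => simp only [map_add, tmul_add, hp, hq]
    | tmul n x =>
      rw [mulLegs_tmul, LinearMap.rTensor_tmul, LinearMap.rTensor_tmul, insertAct_tmul,
        ← Subalgebra.mem_center_iff.1 hz x]
      induction d n with
      | zero => simp
      | add p q hp hq => simp only [map_add, add_tmul, hp, hq]
      | tmul p y => rfl

/-- The braiding is `H`-colinear. -/
lemma IsSemiquasitriangular.diagCoact_braidLin (hR : IsSemiquasitriangular R)
    (hc : ∀ m, c m ∈ tensorCenter k H M) (hac : IsNuCompatible R a c)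
    (hd : ∀ n, d n ∈ tensorCenter k H N) (hbd : IsNuCompatible R b d)
    (hassoc : ∀ n, TensorProduct.assoc k N H H (d.rTensor H (d n)) =
      (Coalgebra.comul (R := k) (A := H)).lTensor N (d n)) :
    (braidLin R a b d).rTensor H ∘ₗ diagCoact c d = diagCoact d c ∘ₗ braidLin R a b d := by
  refine TensorProduct.ext' fun m n => ?_
  -- Colinearity of the insertion: one side is `n₀ ⊗ R₂₁⁻¹ Δ(n₁) R₂₁ · c(m)`, the other `n₀ ⊗ Δ(n₁)
  -- · c(m)`.
  have key : diagCoact d c (insertAct a d (m ⊗ₜ[k] n)) =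
      (insertAct a d).rTensor H (diagCoact c d (m ⊗ₜ[k] n)) := by
    have hconv : ∀ x : N ⊗[k] H, ((coactAct a).toLinearMap.flip (c m) ∘ₗ LinearMap.mul' k _ ∘ₗ
        TensorProduct.map (incRight k H).toLinearMap (nu R)).lTensor N
          ((Coalgebra.comul (R := k) (A := H)).lTensor N x) =
        ((coactAct a).toLinearMap.flip (c m)).lTensor N ((conjComul R).lTensor N x) := by
      intro x
      rw [← conv_incRight_nu]
      induction x with
      | zero => simp
      | add x y hx hy => simp only [map_add, hx, hy]
      | tmul x y => rfl
    rw [insertAct_tmul, diagCoact_evalAt hac, diagCoact_tmul, rTensor_insertAct_mulLegs (hc m),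
      hassoc, hconv, hR.lTensor_conjComul hd hassoc]
  change (tensorAct b a (swap R) ∘ₗ insertAct a d).rTensor H (diagCoact c d (m ⊗ₜ[k] n)) =
    diagCoact d c (tensorAct b a (swap R) (insertAct a d (m ⊗ₜ[k] n)))
  rw [diagCoact_tensorAct hd hbd hac, hR.mul_nu_swap, coactAct₃_inc12, key,
    LinearMap.rTensor_comp, LinearMap.comp_apply]

/-- The braiding is natural. -/
lemma map_comp_braidLin {M' N' : Type u} [AddCommGroup M'] [Module k M'] [AddCommGroup N']
    [Module k N'] {a' : H →ₐ[k] Module.End k M'} {b' : H →ₐ[k] Module.End k N'}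
    {d' : N' →ₗ[k] N' ⊗[k] H} {p : M →ₗ[k] M'} {q : N →ₗ[k] N'}
    (hp : ∀ h, p ∘ₗ a h = a' h ∘ₗ p) (hq : ∀ h, q ∘ₗ b h = b' h ∘ₗ q)
    (hqd : q.rTensor H ∘ₗ d = d' ∘ₗ q) :
    braidLin R a' b' d' ∘ₗ TensorProduct.map p q =
      TensorProduct.map q p ∘ₗ braidLin R a b d := by
  refine TensorProduct.ext' fun m n => ?_
  have h₁ : ∀ w : N ⊗[k] H, TensorProduct.map q p (evalAt N a.toLinearMap m w) =
      evalAt N' a'.toLinearMap (p m) (q.rTensor H w) := by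
    intro w
    induction w with
    | zero => simp
    | add x y hx hy => simp only [map_add, hx, hy]
    | tmul n x => exact congrArg (q n ⊗ₜ[k] ·) (LinearMap.congr_fun (hp x) m)
  have h₂ : q.rTensor H (d n) = d' (q n) := LinearMap.congr_fun hqd n
  rw [LinearMap.comp_apply, LinearMap.comp_apply, TensorProduct.map_tmul, braidLin_tmul,
    braidLin_tmul, ← h₂, ← h₁]
  exact (LinearMap.congr_fun (map_tensorAct q p hq hp (swap R)) _).symm

/-- The first hexagon identity. -/
lemma IsSemiquasitriangular.braidLin_hexagon_forward (hR : IsSemiquasitriangular R)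
    (hd : ∀ n, d n ∈ tensorCenter k H N) (hf : ∀ p, f p ∈ tensorCenter k H P) :
    (TensorProduct.assoc k N P M).toLinearMap ∘ₗ
      braidLin R a (diagAct b e) (diagCoact d f) ∘ₗ (TensorProduct.assoc k M N P).toLinearMap =
    (braidLin R a e f).lTensor N ∘ₗ (TensorProduct.assoc k N M P).toLinearMap ∘ₗ
      (braidLin R a b d).rTensor P := by
  refine TensorProduct.ext_threefold fun m n p => ?_
  -- Centrality of the coaction of `P` lets `X` pass the second insertion. With `X = R₂₁` the
  -- accumulated factor `(R₂₁)₂₃ (R₂₁)₁₃` is `(Δ ⊗ id)(R₂₁)`.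
  have h₁ : ∀ (X : H ⊗[k] H) (w : N ⊗[k] M),
      (braidLin R a e f).lTensor N (TensorProduct.assoc k N M P (tensorAct b a X w ⊗ₜ[k] p)) =
      TensorProduct.assoc k N P M (tensorAct₃ b e a (inc23 k H (swap R) * inc13 k H X)
        ((TensorProduct.assoc k N P M).symm ((insertAct a f).lTensor N
          (TensorProduct.assoc k N M P (w ⊗ₜ[k] p))))) := by
    intro X w
    induction X with
    | zero => simp
    | add x y hx hy => simp only [map_add, mul_add, add_tmul, LinearMap.add_apply, hx, hy]
    | tmul x y =>
      induction w with
      | zero => simp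
      | add x y hx hy => simp only [map_add, add_tmul, hx, hy]
      | tmul n m =>
        rw [tensorAct_tmul_tmul, TensorProduct.assoc_tmul, TensorProduct.assoc_tmul,
          LinearMap.lTensor_tmul, LinearMap.lTensor_tmul, braidLin_tmul, insertAct_tmul,
          evalAt_act a e _ _ (hf p), map_mul, Module.End.mul_apply, tensorAct₃_inc13_assoc_symm,
          tensorAct₃_inc23_assoc_symm, LinearEquiv.apply_symm_apply]
  -- Inserting twice produces `p₁ n₁ · m`, whereas the diagonal coaction produces `n₁ p₁ · m`; they
  -- agree because `n₁` is central.
  have h₂ : ∀ (u : N ⊗[k] H), u ∈ tensorCenter k H N →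
      (insertAct a f).lTensor N (TensorProduct.assoc k N M P
        (evalAt N a.toLinearMap m u ⊗ₜ[k] p)) = TensorProduct.assoc k N P M
          (evalAt (N ⊗[k] P) a.toLinearMap m (mulLegs (u ⊗ₜ[k] f p))) := by
    intro u hu
    refine tensorCenter_induction (p := fun u => (insertAct a f).lTensor N
      (TensorProduct.assoc k N M P (evalAt N a.toLinearMap m u ⊗ₜ[k] p)) =
        TensorProduct.assoc k N P M
          (evalAt (N ⊗[k] P) a.toLinearMap m (mulLegs (u ⊗ₜ[k] f p)))) ?_ ?_ ?_ hu
    · simp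
    · intro u v hu hv
      simp only [map_add, add_tmul, hu, hv]
    · intro n z hz
      rw [evalAt_tmul, TensorProduct.assoc_tmul, LinearMap.lTensor_tmul, insertAct_tmul]
      induction f p with
      | zero => simp
      | add x y hx hy => simp only [map_add, tmul_add, hx, hy]
      | tmul p y =>
        rw [mulLegs_tmul, evalAt_tmul, evalAt_tmul, TensorProduct.assoc_tmul,
          ← Subalgebra.mem_center_iff.1 hz y, AlgHom.toLinearMap_apply, AlgHom.toLinearMap_apply,
          AlgHom.toLinearMap_apply, map_mul]
        rfl
  change TensorProduct.assoc k N P M (braidLin R a (diagAct b e) (diagCoact d f)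
    (m ⊗ₜ[k] (n ⊗ₜ[k] p))) = (braidLin R a e f).lTensor N
      (TensorProduct.assoc k N M P (braidLin R a b d (m ⊗ₜ[k] n) ⊗ₜ[k] p))
  rw [braidLin_tmul, braidLin_tmul, h₁, h₂ _ (hd n), LinearEquiv.symm_apply_apply,
    ← hR.rTensor_comul_swap, tensorAct_diagAct_left, diagCoact_tmul]
  rfl

/-- The second hexagon identity. -/
lemma IsSemiquasitriangular.braidLin_hexagon_reverse (hR : IsSemiquasitriangular R)
    (hef : IsNuCompatible R e f)
    (hassoc : ∀ p, TensorProduct.assoc k P H H (f.rTensor H (f p)) =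
      (Coalgebra.comul (R := k) (A := H)).lTensor P (f p)) :
    (TensorProduct.assoc k P M N).symm.toLinearMap ∘ₗ
      braidLin R (diagAct a b) e f ∘ₗ (TensorProduct.assoc k M N P).symm.toLinearMap =
    (braidLin R a e f).rTensor N ∘ₗ (TensorProduct.assoc k M P N).symm.toLinearMap ∘ₗ
      (braidLin R b e f).lTensor M := by
  refine TensorProduct.ext (LinearMap.ext fun m => TensorProduct.ext' fun n p => ?_)
  -- Here `X` acts on `P` before the second coaction, so passing it through costs a `ν` on its first
  -- leg. For `X = R₂₁` this is harmless by `rTensor_nu_swap`, and `(R₂₁)₁₂ (R₂₁)₁₃` is `(id ⊗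
  -- Δ)(R₂₁)`.
  have h₁ : ∀ (X : H ⊗[k] H) (w : P ⊗[k] N),
      (braidLin R a e f).rTensor N
        ((TensorProduct.assoc k M P N).symm (m ⊗ₜ[k] tensorAct e b X w)) =
      tensorAct₃ e a b (inc12 k H (swap R) * (nu R).rTensor H X)
        ((insertAct a f).rTensor N ((TensorProduct.assoc k M P N).symm (m ⊗ₜ[k] w))) := by
    intro X w
    induction X with
    | zero => simp
    | add x y hx hy => simp only [map_add, mul_add, tmul_add, LinearMap.add_apply, hx, hy]
    | tmul x y =>
      induction w with
      | zero => simp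
      | add x y hx hy => simp only [map_add, tmul_add, hx, hy]
      | tmul p n =>
        rw [tensorAct_tmul_tmul, TensorProduct.assoc_symm_tmul, TensorProduct.assoc_symm_tmul,
          LinearMap.rTensor_tmul, LinearMap.rTensor_tmul, LinearMap.rTensor_tmul, braidLin_tmul,
          insertAct_tmul, hef, evalAt_coactAct, map_mul, Module.End.mul_apply, tensorAct₃_tmul,
          tensorAct₃_inc12_tmul]
  -- The two insertions give `p₀ ⊗ p₁ · m ⊗ p₂ · n`, which by coassociativity is `p₀ ⊗ Δ(p₁) · (m ⊗
  -- n)`.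
  have h₂ : ∀ w : P ⊗[k] H, (insertAct a f).rTensor N
      ((TensorProduct.assoc k M P N).symm (m ⊗ₜ[k] evalAt P b.toLinearMap n w)) =
      (TensorProduct.assoc k P M N).symm
        (((tensorAct a b).toLinearMap.flip (m ⊗ₜ[k] n)).lTensor P
          (TensorProduct.assoc k P H H (f.rTensor H w))) := by
    intro w
    induction w with
    | zero => simp
    | add x y hx hy => simp only [map_add, tmul_add, hx, hy]
    | tmul p x =>
      rw [evalAt_tmul, TensorProduct.assoc_symm_tmul, LinearMap.rTensor_tmul, insertAct_tmul,
        LinearMap.rTensor_tmul]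
      induction f p with
      | zero => simp
      | add x y hx hy => simp only [map_add, add_tmul, hx, hy]
      | tmul p y => rfl
  have h₃ : ∀ w : P ⊗[k] H, evalAt P (diagAct a b).toLinearMap (m ⊗ₜ[k] n) w =
      ((tensorAct a b).toLinearMap.flip (m ⊗ₜ[k] n)).lTensor P
        ((Coalgebra.comul (R := k) (A := H)).lTensor P w) := by
    intro w
    induction w with
    | zero => simp
    | add x y hx hy => simp only [map_add, hx, hy]
    | tmul p x => rfl
  change (TensorProduct.assoc k P M N).symm (braidLin R (diagAct a b) e f
    ((m ⊗ₜ[k] n) ⊗ₜ[k] p)) = (braidLin R a e f).rTensor N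
      ((TensorProduct.assoc k M P N).symm (m ⊗ₜ[k] braidLin R b e f (n ⊗ₜ[k] p)))
  rw [braidLin_tmul, braidLin_tmul, h₁, h₂, hassoc, assoc_symm_tensorAct_diagAct,
    hR.lTensor_comul_swap, hR.rTensor_nu_swap, h₃]

end Twist

end SemiQT

namespace SemiQT

/-! ### Assembly of the braided monoidal category. -/

section Category

variable {k : Type u} {H : Type v} [Field k] [Ring H] [HopfAlgebra k H] {R : H ⊗[k] H}

open ModComod

/-- Closure suffices: the constraints and coherence laws are inherited from `ModComod`. -/
lemma IsSemiquasitriangular.isMonoidal_isNormal (hR : IsSemiquasitriangular R) :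
    (IsNormal R).IsMonoidal where
  prop_unit := hR.isNormal_unit
  prop_tensor _ _ := hR.isNormal_tensor

/-- The braiding of two normal `(H, R)`-modules. -/
def IsSemiquasitriangular.braidIso (hR : IsSemiquasitriangular R) {M N : ModComod k H}
    (hM : IsNormal R M) (hN : IsNormal R N) : tensor M N ≅ tensor N M :=
  isoOfEquiv (M := tensor M N) (N := tensor N M) (hR.braidEquiv M N)
    (fun h => by
      change braidMap R M N ∘ₗ _ = _ ∘ₗ braidMap R M N
      rw [braidMap_eq_braidLin]
      exact hR.braidLin_diagAct hN.1 hN.2 h)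
    (by
      change (braidMap R M N).rTensor H ∘ₗ _ = _ ∘ₗ braidMap R M N
      rw [braidMap_eq_braidLin]
      exact hR.diagCoact_braidLin hM.1 hM.2 hN.1 hN.2 (LinearMap.congr_fun N.coassoc))

lemma IsSemiquasitriangular.braidIso_hom_lin (hR : IsSemiquasitriangular R) {M N : ModComod k H}
    (hM : IsNormal R M) (hN : IsNormal R N) :
    Hom.lin (hR.braidIso hM hN).hom = braidLin R M.act N.act N.coact :=
  braidMap_eq_braidLin R M N

lemma NormalModule.hom_ext {M N : NormalModule R} {f g : M ⟶ N}
    (h : Hom.lin f.hom = Hom.lin g.hom) : f = g :=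
  ObjectProperty.hom_ext _ (ModComod.hom_ext h)

/-- The braided category of normal `(H, R)`-modules. -/
abbrev IsSemiquasitriangular.braidedCategory (hR : IsSemiquasitriangular R)
    [(IsNormal R).IsMonoidal] : BraidedCategory (NormalModule R) where
  braiding M N := (IsNormal R).isoMk (hR.braidIso M.property N.property)
  braiding_naturality_right M N P f := NormalModule.hom_ext <| by
    change Hom.lin (hR.braidIso M.property P.property).hom ∘ₗ
      TensorProduct.map LinearMap.id f.hom.lin =
      TensorProduct.map f.hom.lin LinearMap.id ∘ₗ
        Hom.lin (hR.braidIso M.property N.property).hom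
    rw [hR.braidIso_hom_lin, hR.braidIso_hom_lin]
    exact map_comp_braidLin (fun _ => rfl) f.hom.map_act f.hom.map_coact
  braiding_naturality_left {M N} f P := NormalModule.hom_ext <| by
    change Hom.lin (hR.braidIso N.property P.property).hom ∘ₗ
      TensorProduct.map f.hom.lin LinearMap.id =
      TensorProduct.map LinearMap.id f.hom.lin ∘ₗ
        Hom.lin (hR.braidIso M.property P.property).hom
    rw [hR.braidIso_hom_lin, hR.braidIso_hom_lin]
    exact map_comp_braidLin f.hom.map_act (fun _ => rfl) (by simp)
  hexagon_forward M N P := NormalModule.hom_ext <| by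
    have h := hR.braidLin_hexagon_forward (a := M.obj.act) (b := N.obj.act) (e := P.obj.act)
      N.property.1 P.property.1
    change ((TensorProduct.assoc k N.obj P.obj M.obj).toLinearMap ∘ₗ
      Hom.lin (hR.braidIso M.property (hR.isNormal_tensor N.property P.property)).hom) ∘ₗ
        (TensorProduct.assoc k M.obj N.obj P.obj).toLinearMap =
      (TensorProduct.map LinearMap.id (Hom.lin (hR.braidIso M.property P.property).hom) ∘ₗ
        (TensorProduct.assoc k N.obj M.obj P.obj).toLinearMap) ∘ₗ
          TensorProduct.map (Hom.lin (hR.braidIso M.property N.property).hom) LinearMap.id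
    rw [hR.braidIso_hom_lin, hR.braidIso_hom_lin, hR.braidIso_hom_lin]
    exact h
  hexagon_reverse M N P := NormalModule.hom_ext <| by
    have h := hR.braidLin_hexagon_reverse (a := M.obj.act) (b := N.obj.act)
      P.property.2 (LinearMap.congr_fun P.obj.coassoc)
    change ((TensorProduct.assoc k P.obj M.obj N.obj).symm.toLinearMap ∘ₗ
      Hom.lin (hR.braidIso (hR.isNormal_tensor M.property N.property) P.property).hom) ∘ₗ
        (TensorProduct.assoc k M.obj N.obj P.obj).symm.toLinearMap =
      (TensorProduct.map (Hom.lin (hR.braidIso M.property P.property).hom) LinearMap.id ∘ₗ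
        (TensorProduct.assoc k M.obj P.obj N.obj).symm.toLinearMap) ∘ₗ
          TensorProduct.map LinearMap.id (Hom.lin (hR.braidIso N.property P.property).hom)
    rw [hR.braidIso_hom_lin, hR.braidIso_hom_lin, hR.braidIso_hom_lin]
    exact h

end Category

end SemiQT

end

theorem theorem2p5 {k : Type u} {H : Type v} [Field k] [Ring H] [HopfAlgebra k H]
    (R : H ⊗[k] H) (hR : SemiQT.IsSemiquasitriangular R) :
    ∃ (_ : (SemiQT.IsNormal R).IsMonoidal) (_ : BraidedCategory (SemiQT.NormalModule R)),
      (𝟙_ (SemiQT.NormalModule R)).obj = SemiQT.ModComod.unit k H ∧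
      (∀ M N : SemiQT.NormalModule R, (MonoidalCategory.tensorObj M N).obj = SemiQT.ModComod.tensor M.obj N.obj) ∧
      (∀ (M N M' N' : SemiQT.NormalModule R) (f : M ⟶ M') (g : N ⟶ N'),
        (MonoidalCategory.tensorHom f g).hom.lin = TensorProduct.map f.hom.lin g.hom.lin) ∧
      (∀ M N P : SemiQT.NormalModule R,
        (α_ M N P).hom.hom.lin = (TensorProduct.assoc k M.obj N.obj P.obj).toLinearMap) ∧
      (∀ M : SemiQT.NormalModule R,
        (λ_ M).hom.hom.lin = (TensorProduct.lid k M.obj).toLinearMap) ∧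
      (∀ M : SemiQT.NormalModule R,
        (ρ_ M).hom.hom.lin = (TensorProduct.rid k M.obj).toLinearMap) ∧
      (∀ M N : SemiQT.NormalModule R, (β_ M N).hom.hom.lin = SemiQT.braidMap R M.obj N.obj) := by
  have := hR.isMonoidal_isNormal
  exact ⟨this, hR.braidedCategory, rfl, fun _ _ => rfl, fun _ _ _ _ _ _ => rfl,
    fun _ _ _ => rfl, fun _ => rfl, fun _ => rfl, fun _ _ => rfl⟩
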